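/- Let $R$ be a commutative Noetherian ring. A finitely generated $R$-module $G$ belongs to the $G$-class $G(R)$ if $\operatorname{Ext}^i_R(G,R)=0$ and $\operatorname{Ext}^i_R(\operatorname{Hom}_R(G,R),R)=0$ for all $i>0$ and the biduality map $G\to\operatorname{Hom}_R(\operatorname{Hom}_R(G,R),R)$ is an isomorphism. The Gorenstein dimension $\operatorname{Gdim}_R L$ of a finitely generated $R$-module $L$ is $-\infty$ if $L=0$; if $L\neq 0$ it is the least $n\in\mathbb N_0$ for which there is an exact sequence $0\to G_n\to\cdots\to G_1\to G_0\to L\to 0$ with all $G_l\in G(R)$, and $\infty$ if no such $n$ exists. For a finitely generated $R$-module $M$ and $t\in\mathbb N_0\cup\{-\infty\}$ put $$C_t(M)=\{\mathfrak p\in\operatorname{Spec}R \mid \operatorname{Gdim}_{R_{\mathfrak p}}M_{\mathfrak p}>t\},\qquad c_t(M)=\bigcap_{\mathfrak p\in C_t(M)}\mathfrak p,$$ where $c_t(M)=R$ if $C_t(M)=\emptyset$. For a proper ideal $\mathfrak a$ of $R$ let $\operatorname{grade}(\mathfrak a,R)$ be the supremum of the lengths of the $R$-regular sequences contained in $\mathfrak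 a$, and let $H^i_{\mathfrak a}(M)=\varinjlim_{n\ge 1}\operatorname{Ext}^i_R(R/\mathfrak a^n,M)$ be the $i$-th local cohomology module. **Lemma 2.7.** Let $M$ be a finitely generated $R$-module and $t\in\mathbb N_0\cup\{-\infty\}$. Then there exists $k\in\mathbb N_0$ (depending only on $R$, $M$ and $t$) such that, for every proper ideal $\mathfrak a$ of $R$, $$c_t(M)^k\,H^i_{\mathfrak a}(M)=0\qquad\text{for all } i\in\mathbb N_0 \text{ with } i<\operatorname{grade}(\mathfrak a,R)-t,$$ where $\operatorname{grade}(\mathfrak a,R)-(-\infty)=\infty$, so that for $t=-\infty$ the equality holds for all $i\in\mathbb N_0$. -/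

import Mathlib

universe u

open CategoryTheory

/-- The `G`-class `G(R)`: the finitely generated `R`-modules `M` with `Ext^i_R(M, R) = 0` and
`Ext^i_R(Hom_R(M, R), R) = 0` for all `i > 0`, whose biduality map
`M → Hom_R(Hom_R(M, R), R)` is an isomorphism. -/
structure InGClass (R : Type u) [CommRing R] (M : Type u) [AddCommGroup M] [Module R M] :
    Prop where
  finite : Module.Finite R M
  ext_eq_zero : ∀ i : ℕ, 0 < i →
    Subsingleton (Abelian.Ext (ModuleCat.of R M) (ModuleCat.of R R) i)
  ext_dual_eq_zero : ∀ i : ℕ, 0 < i →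
    Subsingleton (Abelian.Ext (ModuleCat.of R (Module.Dual R M)) (ModuleCat.of R R) i)
  biduality : Function.Bijective (Module.Dual.eval R M)

/-- A `G`-resolution `⋯ → G₂ → G₁ → G₀ → M → 0` of `M`: an exact sequence in which every `Gₗ`
belongs to the `G`-class. -/
structure GResolution (R : Type u) [CommRing R] (M : Type u) [AddCommGroup M] [Module R M] where
  obj : ℕ → ModuleCat.{u} R
  inGClass : ∀ l, InGClass R (obj l)
  d : ∀ l, obj (l + 1) →ₗ[R] obj l
  augmentation : obj 0 →ₗ[R] M
  augmentation_surjective : Function.Surjective augmentation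
  exact_zero : Function.Exact (d 0) augmentation
  exact_succ : ∀ l, Function.Exact (d (l + 1)) (d l)

/-- A `G`-resolution has length `n` if `Gₙ ≠ 0` and `Gₗ = 0` for all `l > n`. -/
def GResolution.HasLength {R : Type u} [CommRing R] {M : Type u} [AddCommGroup M] [Module R M]
    (G : GResolution R M) (n : ℕ) : Prop :=
  Nontrivial (G.obj n) ∧ ∀ l, n < l → Subsingleton (G.obj l)

open Classical in
/-- The Gorenstein dimension: `-∞` for the zero module, and otherwise the least length of a
`G`-resolution of `M`, which is `∞` if there is none of finite length. -/
noncomputable def gDim (R : Type u) [CommRing R] (M : Type u) [AddCommGroup M] [Module R M] :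
    WithBot ℕ∞ :=
  if Subsingleton M then ⊥
  else ((⨅ (n : ℕ) (_ : ∃ G : GResolution R M, G.HasLength n), (n : ℕ∞) : ℕ∞) : WithBot ℕ∞)

/-- The inclusion of `ℕ ∪ {-∞}` into `ℕ ∪ {-∞, ∞}`. -/
def toExtended (t : WithBot ℕ) : WithBot ℕ∞ :=
  WithBot.map (fun n : ℕ => (n : ℕ∞)) t

/-- `C_t(M)`, the set of primes `p` of `R` such that the `R_p`-module `M_p` has Gorenstein
dimension `> t`. -/
def gDimLocus (R : Type u) [CommRing R] (M : Type u) [AddCommGroup M] [Module R M]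
    (t : WithBot ℕ) : Set (PrimeSpectrum R) :=
  {p | toExtended t <
    gDim (Localization.AtPrime p.asIdeal) (LocalizedModule p.asIdeal.primeCompl M)}

/-- `c_t(M)`, the intersection of the primes in `C_t(M)` (the unit ideal if there are none). -/
def gDimIdeal (R : Type u) [CommRing R] (M : Type u) [AddCommGroup M] [Module R M]
    (t : WithBot ℕ) : Ideal R :=
  ⨅ p ∈ gDimLocus R M t, p.asIdeal

/-- `grade(a, R)`: the supremum of the lengths of the `R`-regular sequences contained in `a`. -/
noncomputable def idealGrade {R : Type u} [CommRing R] (a : Ideal R) : ℕ∞ :=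
  ⨆ (rs : List R) (_ : (∀ r ∈ rs, r ∈ a) ∧ RingTheory.Sequence.IsRegular R rs),
    (rs.length : ℕ∞)

/-! Let `J` be the intersection of the annihilators of all `Ext^i(R/a^n, M)` in the range. If every
`x ∈ c_t(M)` has a power in `J`, then some power of `c_t(M)` lies in `J`, because the ring is
Noetherian, and annihilation passes to the colimit. When `x ∉ p`, the Gorenstein dimension of `M_p`
is at most `t`. For `t = -∞` a power of `x` kills `M`. For finite `t`, a syzygy lowers `t` by one
and raises the degree by one, because `Ext^j(L, R) = 0` for finitely generated `a`-power torsion `L`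
and `j < grade(a, R)`. This leaves `t = 0`.

Generators of the dual of `N` give a map `N → R^n` that is injective away from `x`, with a cokernel
of the same kind as `N`. Up to a power of `x`, this reduces `Ext^j(L, N)` to `Ext^{j-d}(L, N')`,
with `N'` a `d`-th cosyzygy. Taking `d > j` settles each single `j`, but the exponent then depends
on `j`, and grades can be unbounded.

Uniformity comes from Noetherian induction on an ideal `b` with a power killing `L`. If `b = P` is
prime, there are `f ∉ P` and a constant `d` such that, up to `f`-torsion, vanishing of `Ext(L, R)`
through degree `j` gives vanishing of `Ext(L, R/P)` through `j - d` (`TorsionDescent`), hence of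
`Ext^{j-d}(L, N')` (`TorsionTransfer`). So `d` cosyzygies suffice for every `j`, and the kernel and
cokernel of `f^s` on `L` fall under the larger ideal `b + (f)`. If `b` is not prime, `L` is
filtered. The case `b = 0` covers every `L`. -/

/-! ### Long exact sequences of `Ext` up to torsion. -/

section ExtAnnihilation

variable {R : Type u} [CommRing R]
variable {A B C L L' L'' N : Type u} [AddCommGroup A] [Module R A] [AddCommGroup B] [Module R B]
  [AddCommGroup C] [Module R C] [AddCommGroup L] [Module R L] [AddCommGroup L'] [Module R L']
  [AddCommGroup L''] [Module R L''] [AddCommGroup N] [Module R N]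

/-- Every element of `Ext^i(L, N)` is annihilated by `f ^ s * w` for some `s`. For `f = 1` this says
that `w` annihilates `Ext^i(L, N)`, and for `w = 1` that `Ext^i(L, N)` is `f`-power torsion. -/
def ExtAnnihilatedUpTo (f w : R) (L N : Type u) [AddCommGroup L] [Module R L] [AddCommGroup N]
    [Module R N] (i : ℕ) : Prop :=
  ∀ ξ : Abelian.Ext (ModuleCat.of R L) (ModuleCat.of R N) i, ∃ s : ℕ, (f ^ s * w) • ξ = 0

/-- The short complex of modules attached to an exact pair of linear maps. -/
abbrev exactShortComplex (φ : A →ₗ[R] B) (ψ : B →ₗ[R] C) (h : Function.Exact φ ψ) :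
    ShortComplex (ModuleCat.{u} R) :=
  ModuleCat.shortComplexOfCompEqZero φ ψ h.linearMap_comp_eq_zero

lemma exactShortComplex_shortExact {φ : A →ₗ[R] B} {ψ : B →ₗ[R] C} (h : Function.Exact φ ψ)
    (hφ : Function.Injective φ) (hψ : Function.Surjective ψ) :
    (exactShortComplex φ ψ h).ShortExact :=
  ModuleCat.shortComplex_shortExact _ h hφ hψ

namespace ExtAnnihilatedUpTo

open Abelian

lemma of_subsingleton {f : R} {i : ℕ}
    (h : Subsingleton (Ext (ModuleCat.of R L) (ModuleCat.of R N) i)) :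
    ExtAnnihilatedUpTo f 1 L N i := fun _ => ⟨0, Subsingleton.elim _ _⟩

lemma smul_eq_mk₀_comp {X Y : ModuleCat.{u} R} {i : ℕ} (w : R) (ξ : Ext X Y i) :
    w • ξ = (Ext.mk₀ (w • 𝟙 X)).comp ξ (zero_add i) := by
  simp [Ext.mk₀_smul]

lemma smul_ext_eq_zero_of_smul_right_eq_zero {w : R} (hw : ∀ x : N, w • x = 0) {i : ℕ}
    (ξ : Ext (ModuleCat.of R L) (ModuleCat.of R N) i) : w • ξ = 0 := by
  have : w • 𝟙 (ModuleCat.of R N) = 0 := by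
    ext x
    simpa using hw x
  rw [Ext.smul_eq_comp_mk₀, this, Ext.mk₀_zero, Ext.comp_zero]

lemma smul_ext_eq_zero_of_smul_left_eq_zero {w : R} (hw : ∀ x : L, w • x = 0) {i : ℕ}
    (ξ : Ext (ModuleCat.of R L) (ModuleCat.of R N) i) : w • ξ = 0 := by
  have : w • 𝟙 (ModuleCat.of R L) = 0 := by
    ext x
    simpa using hw x
  rw [smul_eq_mk₀_comp, this, Ext.mk₀_zero, Ext.zero_comp]

lemma of_smul_right {f w : R} (hw : ∀ x : N, w • x = 0) (i : ℕ) :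
    ExtAnnihilatedUpTo f w L N i := fun ξ => by
  refine ⟨0, ?_⟩
  rw [pow_zero, one_mul]
  exact smul_ext_eq_zero_of_smul_right_eq_zero hw ξ

lemma of_smul_left {f w : R} (hw : ∀ x : L, w • x = 0) (i : ℕ) :
    ExtAnnihilatedUpTo f w L N i := fun ξ => by
  refine ⟨0, ?_⟩
  rw [pow_zero, one_mul]
  exact smul_ext_eq_zero_of_smul_left_eq_zero hw ξ

lemma of_pow_smul_right {f : R} (s : ℕ) (hw : ∀ x : N, f ^ s • x = 0) (i : ℕ) :
    ExtAnnihilatedUpTo f 1 L N i := fun ξ =>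
  ⟨s, by rw [mul_one]; exact smul_ext_eq_zero_of_smul_right_eq_zero hw ξ⟩

lemma mono_torsion {f f' w : R} (hf : f ∣ f') {i : ℕ} (h : ExtAnnihilatedUpTo f w L N i) :
    ExtAnnihilatedUpTo f' w L N i := fun ξ => by
  obtain ⟨g, rfl⟩ := hf
  obtain ⟨s, hs⟩ := h ξ
  exact ⟨s, by rw [mul_pow, mul_right_comm, mul_comm, mul_smul, hs, smul_zero]⟩

lemma smul_eq_zero {w : R} {i : ℕ} (h : ExtAnnihilatedUpTo 1 w L N i)
    (ξ : Ext (ModuleCat.of R L) (ModuleCat.of R N) i) : w • ξ = 0 := by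
  obtain ⟨s, hs⟩ := h ξ
  simpa using hs

variable {φ : A →ₗ[R] B} {ψ : B →ₗ[R] C}

/-- The part `Ext^i(L, A) → Ext^i(L, B) → Ext^i(L, C)` of the long exact sequence. -/
lemma middle (h : Function.Exact φ ψ) (hφ : Function.Injective φ) (hψ : Function.Surjective ψ)
    {f w₁ w₂ : R} {i : ℕ} (hA : ExtAnnihilatedUpTo f w₁ L A i)
    (hC : ExtAnnihilatedUpTo f w₂ L C i) : ExtAnnihilatedUpTo f (w₁ * w₂) L B i := fun ξ => by
  have hS := exactShortComplex_shortExact h hφ hψ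
  obtain ⟨s, hs⟩ := hC (ξ.comp (Ext.mk₀ (ModuleCat.ofHom ψ)) (add_zero i))
  obtain ⟨η, hη⟩ := Ext.covariant_sequence_exact₂ _ hS ((f ^ s * w₂) • ξ)
    (by rw [Ext.smul_comp]; exact hs)
  obtain ⟨s', hs'⟩ := hA η
  refine ⟨s + s', ?_⟩
  rw [show f ^ (s + s') * (w₁ * w₂) = (f ^ s' * w₁) * (f ^ s * w₂) by ring, mul_smul, ← hη,
    ← Ext.smul_comp, hs', Ext.zero_comp]

/-- The part `Ext^{i-1}(L, C) → Ext^i(L, A) → Ext^i(L, B)` of the long exact sequence. -/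
lemma left (h : Function.Exact φ ψ) (hφ : Function.Injective φ) (hψ : Function.Surjective ψ)
    {f w₁ w₂ : R} {i : ℕ} (hC : ∀ j, j + 1 = i → ExtAnnihilatedUpTo f w₁ L C j)
    (hB : ExtAnnihilatedUpTo f w₂ L B i) : ExtAnnihilatedUpTo f (w₁ * w₂) L A i := fun ξ => by
  have hS := exactShortComplex_shortExact h hφ hψ
  obtain ⟨s, hs⟩ := hB (ξ.comp (Ext.mk₀ (ModuleCat.ofHom φ)) (add_zero i))
  rw [← Ext.smul_comp] at hs
  obtain _ | j := i
  · refine ⟨s, ?_⟩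
    have : Mono (ModuleCat.ofHom φ) := (ModuleCat.mono_iff_injective _).mpr hφ
    have key : (f ^ s * w₂) • ξ = 0 :=
      Ext.postcomp_mk₀_injective_of_mono (ModuleCat.of R L) (ModuleCat.ofHom φ)
        (by simpa using hs)
    rw [mul_left_comm, mul_smul, key, smul_zero]
  · obtain ⟨η, hη⟩ := Ext.covariant_sequence_exact₁ _ hS ((f ^ s * w₂) • ξ) hs rfl
    obtain ⟨s', hs'⟩ := hC j rfl η
    refine ⟨s + s', ?_⟩
    rw [show f ^ (s + s') * (w₁ * w₂) = (f ^ s' * w₁) * (f ^ s * w₂) by ring, mul_smul, ← hη,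
      ← Ext.smul_comp, hs', Ext.zero_comp]

/-- The part `Ext^i(L, B) → Ext^i(L, C) → Ext^{i+1}(L, A)` of the long exact sequence. -/
lemma right (h : Function.Exact φ ψ) (hφ : Function.Injective φ) (hψ : Function.Surjective ψ)
    {f w₁ w₂ : R} {i : ℕ} (hB : ExtAnnihilatedUpTo f w₁ L B i)
    (hA : ExtAnnihilatedUpTo f w₂ L A (i + 1)) :
    ExtAnnihilatedUpTo f (w₁ * w₂) L C i := fun ξ => by
  have hS := exactShortComplex_shortExact h hφ hψ
  obtain ⟨s, hs⟩ := hA (Ext.comp ξ hS.extClass rfl)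
  rw [← Ext.smul_comp] at hs
  obtain ⟨η, hη⟩ := Ext.covariant_sequence_exact₃ _ hS ((f ^ s * w₂) • ξ) rfl hs
  obtain ⟨s', hs'⟩ := hB η
  refine ⟨s + s', ?_⟩
  rw [show f ^ (s + s') * (w₁ * w₂) = (f ^ s' * w₁) * (f ^ s * w₂) by ring, mul_smul, ← hη,
    ← Ext.smul_comp, hs', Ext.zero_comp]

lemma of_linearEquiv (e : A ≃ₗ[R] B) {f w : R} {i : ℕ} (hA : ExtAnnihilatedUpTo f w L A i) :
    ExtAnnihilatedUpTo f w L B i := fun ξ => by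
  obtain ⟨s, hs⟩ := hA (ξ.comp (Ext.mk₀ (ModuleCat.ofHom e.symm.toLinearMap)) (add_zero i))
  refine ⟨s, ?_⟩
  have := congrArg (fun η => η.comp (Ext.mk₀ (ModuleCat.ofHom e.toLinearMap)) (add_zero i)) hs
  simpa [← ModuleCat.ofHom_comp] using this

lemma pi_of_self {f : R} {i : ℕ} (h : ExtAnnihilatedUpTo f 1 L R i) (n : ℕ) :
    ExtAnnihilatedUpTo f 1 L (Fin n → R) i := by
  induction n with
  | zero => exact of_pow_smul_right 0 (fun x => Subsingleton.elim _ _) i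
  | succ n ih =>
    let φ : R →ₗ[R] (Fin (n + 1) → R) := LinearMap.single R (fun _ => R) 0
    let ψ : (Fin (n + 1) → R) →ₗ[R] (Fin n → R) := LinearMap.funLeft R R Fin.succ
    have hex : Function.Exact φ ψ := by
      intro x
      constructor
      · intro hx
        refine ⟨x 0, ?_⟩
        ext j
        refine Fin.cases ?_ (fun j => ?_) j
        · simp [φ]
        · have := congrFun hx j
          simp only [ψ, LinearMap.funLeft_apply, Pi.zero_apply] at this
          simp [φ, this]
      · rintro ⟨a, rfl⟩
        ext j
        simp [φ, ψ, LinearMap.funLeft_apply]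
    have := middle hex (LinearMap.ker_eq_bot.mp (LinearMap.ker_single R (fun _ => R) 0))
      (LinearMap.funLeft_surjective_of_injective R R Fin.succ (Fin.succ_injective n)) h ih
    simpa using this

/-- The part `Ext^i(L'', N) → Ext^i(L, N) → Ext^i(L', N)` of the long exact sequence. -/
lemma contravariant_middle {α : L' →ₗ[R] L} {β : L →ₗ[R] L''} (h : Function.Exact α β)
    (hα : Function.Injective α) (hβ : Function.Surjective β) {f w₁ w₂ : R} {i : ℕ}
    (h' : ExtAnnihilatedUpTo f w₁ L' N i) (h'' : ExtAnnihilatedUpTo f w₂ L'' N i) :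
    ExtAnnihilatedUpTo f (w₁ * w₂) L N i := fun ξ => by
  have hS := exactShortComplex_shortExact h hα hβ
  obtain ⟨s, hs⟩ := h' ((Ext.mk₀ (ModuleCat.ofHom α)).comp ξ (zero_add i))
  rw [← Ext.comp_smul] at hs
  obtain ⟨η, hη⟩ := Ext.contravariant_sequence_exact₂ hS (ModuleCat.of R N) ((f ^ s * w₁) • ξ) hs
  obtain ⟨s', hs'⟩ := h'' η
  refine ⟨s + s', ?_⟩
  rw [show f ^ (s + s') * (w₁ * w₂) = (f ^ s' * w₂) * (f ^ s * w₁) by ring, mul_smul, ← hη,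
    ← Ext.comp_smul, hs', Ext.comp_zero]

/-- If `y` is injective on `B` with cokernel `C`, then `y` is injective on `Ext^i(L, B)` up to
`f`-torsion whenever `Ext^{i-1}(L, C)` is `f`-torsion. -/
lemma of_injective_of_pow_smul {y : R} {ψ : B →ₗ[R] C} (h : Function.Exact (LinearMap.lsmul R B y) ψ)
    (hy : Function.Injective (LinearMap.lsmul R B y)) (hψ : Function.Surjective ψ) {f : R} {i : ℕ}
    (hC : ∀ j, j + 1 = i → ExtAnnihilatedUpTo f 1 L C j) (m : ℕ) (hm : ∀ x : L, y ^ m • x = 0) :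
    ExtAnnihilatedUpTo f 1 L B i := by
  have hS := exactShortComplex_shortExact h hy hψ
  have hid : ModuleCat.ofHom (LinearMap.lsmul R B y) = y • 𝟙 (ModuleCat.of R B) := by
    ext x
    simp
  -- A class killed by `y` comes from `Ext^{i-1}(L, C)`, or is zero if `i = 0`. Since `y ^ m` kills
  -- every class, iterating `m` times is enough.
  have step : ∀ ξ : Ext (ModuleCat.of R L) (ModuleCat.of R B) i, y • ξ = 0 →
      ∃ s, f ^ s • ξ = 0 := by
    intro ξ hξ
    rw [Ext.smul_eq_comp_mk₀, ← hid] at hξ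
    obtain _ | j := i
    · refine ⟨0, ?_⟩
      have : Mono (ModuleCat.ofHom (LinearMap.lsmul R B y)) :=
        (ModuleCat.mono_iff_injective _).mpr hy
      rw [pow_zero, one_smul]
      exact Ext.postcomp_mk₀_injective_of_mono (ModuleCat.of R L)
        (ModuleCat.ofHom (LinearMap.lsmul R B y)) (by simpa using hξ)
    · obtain ⟨η, hη⟩ := Ext.covariant_sequence_exact₁ _ hS ξ hξ rfl
      obtain ⟨s', hs'⟩ := hC j rfl η
      refine ⟨s', ?_⟩
      rw [mul_one] at hs'
      rw [← hη, ← Ext.smul_comp, hs', Ext.zero_comp]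
  have iter : ∀ (n : ℕ) (ξ : Ext (ModuleCat.of R L) (ModuleCat.of R B) i), y ^ n • ξ = 0 →
      ∃ s, f ^ s • ξ = 0 := by
    intro n
    induction n with
    | zero => intro ξ hξ; exact ⟨0, by simpa using hξ⟩
    | succ n ih =>
      intro ξ hξ
      obtain ⟨s, hs⟩ := ih (y • ξ) (by rw [smul_smul, ← pow_succ, hξ])
      obtain ⟨s', hs'⟩ := step (f ^ s • ξ) (by rw [smul_comm, hs])
      exact ⟨s' + s, by rw [pow_add, mul_smul, hs']⟩
  intro ξ
  obtain ⟨s, hs⟩ := iter m ξ (smul_ext_eq_zero_of_smul_left_eq_zero hm ξ)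
  exact ⟨s, by rw [mul_one, hs]⟩

end ExtAnnihilatedUpTo

end ExtAnnihilation

/-! ### From `Ext` into `R/P` to `Ext` into finite modules, away from `P`. -/

section TorsionTransfer

variable {R : Type u} [CommRing R]

/-- After inverting some `f ∉ P`, the modules `Ext^i(L, C)` vanish in the range in which
`Ext^i(L, R/P)` does, for all `L` annihilated by a power of every element of `P`. -/
def TorsionTransfer (P : Ideal R) (C : Type u) [AddCommGroup C] [Module R C] : Prop :=
  ∃ f ∉ P, ∀ f', f ∣ f' → ∀ (L : Type u) [AddCommGroup L] [Module R L] (m : ℕ),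
    (∀ y ∈ P, ∀ x : L, y ^ m • x = 0) → ∀ i, (∀ j ≤ i, ExtAnnihilatedUpTo f' 1 L (R ⧸ P) j) →
      ExtAnnihilatedUpTo f' 1 L C i

variable {A B C : Type u} [AddCommGroup A] [Module R A] [AddCommGroup B] [Module R B]
  [AddCommGroup C] [Module R C]

namespace TorsionTransfer

/-- Allowing all multiples of `f` in `TorsionTransfer` lets two choices be merged into their
product, which avoids `P` by primality. -/
lemma of_exact {P : Ideal R} [hP : P.IsPrime] {φ : A →ₗ[R] B} {ψ : B →ₗ[R] C}
    (h : Function.Exact φ ψ) (hφ : Function.Injective φ) (hψ : Function.Surjective ψ)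
    (hA : TorsionTransfer P A) (hC : TorsionTransfer P C) : TorsionTransfer P B := by
  obtain ⟨f, hf, hA⟩ := hA
  obtain ⟨g, hg, hC⟩ := hC
  refine ⟨f * g, fun hfg => (hP.mem_or_mem hfg).elim hf hg, ?_⟩
  intro f' hf' L _ _ m hm i hi
  have := ExtAnnihilatedUpTo.middle h hφ hψ
    (hA f' ((Dvd.intro _ rfl).trans hf') L m hm i hi)
    (hC f' ((Dvd.intro_left _ rfl).trans hf') L m hm i hi)
  simpa using this

lemma of_linearEquiv {P : Ideal R} (e : A ≃ₗ[R] B) (hA : TorsionTransfer P A) :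
    TorsionTransfer P B := by
  obtain ⟨f, hf, hA⟩ := hA
  exact ⟨f, hf, fun f' hf' L _ _ m hm i hi => (hA f' hf' L m hm i hi).of_linearEquiv e⟩

lemma of_smul_eq_zero {P : Ideal R} {f : R} (hf : f ∉ P) (h : ∀ x : A, f • x = 0) :
    TorsionTransfer P A :=
  ⟨f, hf, fun _ hf' _ _ _ _ _ i _ => ExtAnnihilatedUpTo.mono_torsion hf'
    (ExtAnnihilatedUpTo.of_pow_smul_right 1 (by simpa using h) i)⟩

lemma self (P : Ideal R) [hP : P.IsPrime] : TorsionTransfer P (R ⧸ P) :=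
  ⟨1, fun h => hP.ne_top ((Ideal.eq_top_iff_one P).mpr h), fun _ _ _ _ _ _ _ i hi => hi i le_rfl⟩

/-- The projection `R/I → R/J` for `I ≤ J`. -/
def idealFactor {I J : Ideal R} (h : I ≤ J) : (R ⧸ I) →ₗ[R] R ⧸ J :=
  Submodule.mapQ I J LinearMap.id h

lemma factor_surjective {I J : Ideal R} (h : I ≤ J) : Function.Surjective (idealFactor h) := by
  intro x
  obtain ⟨x, rfl⟩ := Submodule.Quotient.mk_surjective _ x
  exact ⟨Submodule.Quotient.mk x, rfl⟩

/-- The ideal `(I : u)`. -/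
def colonElement (I : Ideal R) (u : R) : Ideal R :=
  Submodule.comap (LinearMap.lsmul R R u) I

lemma le_colonElement (I : Ideal R) (u : R) : I ≤ colonElement I u :=
  fun _ hx => I.mul_mem_left u hx

/-- Multiplication by `u`, as an injective map `R/(I : u) → R/I`. -/
def quotientMul (I : Ideal R) (u : R) : (R ⧸ colonElement I u) →ₗ[R] R ⧸ I :=
  Submodule.mapQ _ _ (LinearMap.lsmul R R u) le_rfl

lemma quotientMul_injective (I : Ideal R) (u : R) : Function.Injective (quotientMul I u) := by
  refine (injective_iff_map_eq_zero _).mpr fun x hx => ?_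
  obtain ⟨x, rfl⟩ := Submodule.Quotient.mk_surjective _ x
  have hx : u * x ∈ I := (Submodule.Quotient.mk_eq_zero _).mp hx
  exact (Submodule.Quotient.mk_eq_zero _).mpr hx

lemma exact_quotientMul (I : Ideal R) (u : R) :
    Function.Exact (quotientMul I u)
      (idealFactor (le_sup_left : I ≤ I ⊔ Ideal.span {u})) := by
  intro x
  obtain ⟨x, rfl⟩ := Submodule.Quotient.mk_surjective _ x
  constructor
  · intro hx
    have hx : x ∈ I ⊔ Ideal.span {u} := (Submodule.Quotient.mk_eq_zero _).mp hx
    obtain ⟨a, ha, b, hb, rfl⟩ := Submodule.mem_sup.mp hx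
    obtain ⟨c, rfl⟩ := Ideal.mem_span_singleton'.mp hb
    refine ⟨Submodule.Quotient.mk c, ?_⟩
    refine (Submodule.Quotient.eq _).mpr ?_
    simpa [mul_comm] using ha
  · rintro ⟨c, hc⟩
    obtain ⟨c, rfl⟩ := Submodule.Quotient.mk_surjective _ c
    rw [← hc]
    refine (Submodule.Quotient.mk_eq_zero _).mpr ?_
    exact Ideal.mem_sup_right (Ideal.mem_span_singleton'.mpr ⟨c, by simp [mul_comm]⟩)


lemma lt_sup_span {I : Ideal R} {u : R} (hu : u ∉ I) : I < I ⊔ Ideal.span {u} :=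
  lt_of_le_of_ne le_sup_left fun h => hu (h ▸ Ideal.mem_sup_right (Ideal.mem_span_singleton_self u))

/-- Noetherian induction on `I`. For `I ⊄ P` an element outside `P` kills `R/I`. For a prime `I <
P`, some `y ∈ P \ I` is injective on `R/I` but nilpotent on `Ext(L, R/I)`, with cokernel `R/(I +
(y))`. For `uv ∈ I` with `u, v ∉ I`, `R/I` is an extension of `R/(I + (u))` by `R/(I : u)`. -/
lemma quotient [IsNoetherianRing R] (P : Ideal R) [hP : P.IsPrime] (I : Ideal R) :
    TorsionTransfer P (R ⧸ I) := by
  induction I using WellFoundedGT.induction with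
  | ind I ih =>
    by_cases hle : I ≤ P
    swap
    · obtain ⟨f, hfI, hfP⟩ := SetLike.not_le_iff_exists.mp hle
      refine of_smul_eq_zero hfP fun x => ?_
      obtain ⟨x, rfl⟩ := Submodule.Quotient.mk_surjective _ x
      exact (Submodule.Quotient.mk_eq_zero _).mpr (I.mul_mem_right x hfI)
    by_cases hI : I.IsPrime
    · rcases hle.eq_or_lt with rfl | hlt
      · exact self I
      obtain ⟨y, hyP, hyI⟩ := SetLike.exists_of_lt hlt
      obtain ⟨f, hf, hT⟩ := ih _ (lt_sup_span hyI)
      refine ⟨f, hf, fun f' hf' L _ _ m hm i hi => ?_⟩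
      refine ExtAnnihilatedUpTo.of_injective_of_pow_smul
        (ψ := idealFactor (le_sup_left : I ≤ I ⊔ Ideal.span {y})) ?_ ?_
        (factor_surjective _) (fun j hj => hT f' hf' L m hm j fun k hk => hi k (by omega)) m
        (hm y hyP)
      -- `quotientMul I y` and multiplication by `y` on `R/I` have the same range.
      · intro x
        rw [exact_quotientMul I y x]
        constructor
        · rintro ⟨c, rfl⟩
          obtain ⟨c, rfl⟩ := Submodule.Quotient.mk_surjective _ c
          exact ⟨Submodule.Quotient.mk c, rfl⟩
        · rintro ⟨c, rfl⟩
          obtain ⟨c, rfl⟩ := Submodule.Quotient.mk_surjective _ c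
          exact ⟨Submodule.Quotient.mk c, rfl⟩
      · refine (injective_iff_map_eq_zero _).mpr fun x hx => ?_
        obtain ⟨x, rfl⟩ := Submodule.Quotient.mk_surjective _ x
        have : y * x ∈ I := (Submodule.Quotient.mk_eq_zero _).mp hx
        exact (Submodule.Quotient.mk_eq_zero _).mpr ((hI.mem_or_mem this).resolve_left hyI)
    · have hne : I ≠ ⊤ := fun h => hP.ne_top (top_le_iff.mp (h ▸ hle))
      obtain ⟨u, hu, v, hv, huv⟩ := (Ideal.not_isPrime_iff.mp hI).resolve_left hne
      refine of_exact (exact_quotientMul I u) (quotientMul_injective I u) (factor_surjective _)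
        (ih _ ?_) (ih _ (lt_sup_span hu))
      refine lt_of_le_of_ne (le_colonElement I u) fun h => hv ?_
      rw [h]
      exact huv

lemma of_finite [IsNoetherianRing R] (P : Ideal R) [P.IsPrime] (C : Type u) [AddCommGroup C]
    [Module R C] [hC : Module.Finite R C] : TorsionTransfer P C := by
  induction hC using IsNoetherianRing.induction_on_isQuotientEquivQuotientPrime R with
  | subsingleton N =>
    exact of_linearEquiv (A := R ⧸ (⊤ : Ideal R)) (LinearEquiv.ofSubsingleton _ _) (quotient P ⊤)
  | quotient N p e => exact of_linearEquiv e.symm (quotient P p.1)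
  | exact N₁ N₂ N₃ f g hf hg hfg h₁ h₃ => exact of_exact hfg hf hg h₁ h₃

end TorsionTransfer

/-! ### From `Ext` into `R` back to `Ext` into `R/P`, with a bounded shift. -/

/-- After inverting some `f ∉ P`, the modules `Ext^i(L, R/P)` vanish in the range, shifted by `d`, in
which `Ext^i(L, C)` does. -/
def TorsionDescent (P : Ideal R) (C : Type u) [AddCommGroup C] [Module R C] : Prop :=
  ∃ d : ℕ, ∃ f ∉ P, ∀ f', f ∣ f' → ∀ (L : Type u) [AddCommGroup L] [Module R L] (m : ℕ),
    (∀ y ∈ P, ∀ x : L, y ^ m • x = 0) → ∀ j, (∀ i ≤ j, ExtAnnihilatedUpTo f' 1 L C i) →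
      ∀ i, i + d ≤ j → ExtAnnihilatedUpTo f' 1 L (R ⧸ P) i

open TorsionTransfer

namespace TorsionDescent

/-- `Ext^i(L, R/P)` sits between `Ext^{i-1}` into the cokernel and `Ext^i(L, C)`. The former is
controlled by `Ext^l(L, R/P)` with `l < i`, so strong induction on `i` needs no shift. -/
lemma of_injective [IsNoetherianRing R] {P : Ideal R} [P.IsPrime] [Module.Finite R C]
    {φ : R ⧸ P →ₗ[R] C} (hφ : Function.Injective φ) : TorsionDescent P C := by
  obtain ⟨f, hf, hT⟩ := TorsionTransfer.of_finite P (C ⧸ LinearMap.range φ)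
  refine ⟨0, f, hf, fun f' hf' L _ _ m hm j hj i hi => ?_⟩
  induction i using Nat.strong_induction_on with
  | _ i ih =>
    have := ExtAnnihilatedUpTo.left (f := f') (L := L) (i := i) (w₁ := 1) (w₂ := 1)
      (LinearMap.exact_map_mkQ_range φ) hφ (Submodule.mkQ_surjective _)
      (fun k hk => hT f' hf' L m hm k fun l hl => ih l (by omega) (by omega)) (hj i (by omega))
    simpa using this

/-- If `P` contains a prime ideal but no associated prime of `R/I` equals `P`, then some `y ∈ P` is
a nonzerodivisor on `R/I` up to torsion away from `P`. -/
lemma exists_mem_colon [IsNoetherianRing R] {P I : Ideal R} [hP : P.IsPrime]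
    (h : P ∉ associatedPrimes R (R ⧸ I)) :
    ∃ y ∈ P, ∃ f ∉ P, ∀ r : R, y * r ∈ I → f * r ∈ I := by
  classical
  -- Prime avoidance for the finitely many associated primes inside `P`.
  obtain ⟨y, hyP, hy⟩ : ∃ y ∈ P, ∀ Q ∈ associatedPrimes R (R ⧸ I), Q ≤ P → y ∉ Q := by
    by_contra! hcon
    have hfin : {Q ∈ associatedPrimes R (R ⧸ I) | Q ≤ P}.Finite :=
      (associatedPrimes.finite R (R ⧸ I)).subset fun Q hQ => hQ.1
    have hsub : (P : Set R) ⊆ ⋃ Q ∈ {Q ∈ associatedPrimes R (R ⧸ I) | Q ≤ P}, (Q : Set R) := by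
      intro y hy
      obtain ⟨Q, hQ, hQP, hyQ⟩ := hcon y hy
      exact Set.mem_biUnion (show Q ∈ {Q ∈ associatedPrimes R (R ⧸ I) | Q ≤ P} from ⟨hQ, hQP⟩) hyQ
    obtain ⟨Q, hQ, hPQ⟩ := (P.subset_union_prime_finite hfin (f := id) ⊥ ⊥
      fun Q hQ _ _ => hQ.1.isPrime).mp hsub
    exact h (le_antisymm hPQ hQ.2 ▸ hQ.1)
  refine ⟨y, hyP, ?_⟩
  let K : Submodule R (R ⧸ I) := LinearMap.ker (LinearMap.lsmul R (R ⧸ I) y)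
  -- Otherwise a prime inside `P` minimal over this annihilator is associated to `R/I` and contains
  -- `y`.
  have hK : ¬ Module.annihilator R K ≤ P := by
    intro hle
    obtain ⟨Q, hQmin, hQP⟩ := Ideal.exists_minimalPrimes_le hle
    have hQ : Q ∈ associatedPrimes R K :=
      Module.associatedPrimes.minimalPrimes_annihilator_subset_associatedPrimes R K hQmin
    refine hy Q (associatedPrimes.subset_of_injective K.injective_subtype hQ) hQP ?_
    refine hQmin.1.2 ?_
    rw [Module.mem_annihilator]
    rintro ⟨x, hx⟩
    exact Subtype.ext hx
  obtain ⟨f, hf, hfP⟩ := SetLike.not_le_iff_exists.mp hK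
  refine ⟨f, hfP, fun r hr => ?_⟩
  have hr' : Submodule.Quotient.mk (p := I) r ∈ K := (Submodule.Quotient.mk_eq_zero _).mpr hr
  have := congrArg Subtype.val (Module.mem_annihilator.mp hf ⟨_, hr'⟩)
  exact (Submodule.Quotient.mk_eq_zero _).mp this

/-- Elements of `P` that are regular on `R/I` near `P` are added to `I` until `P` becomes associated
and `R/P` embeds. The process stops by Noetherianity, so the total shift depends only on `P` and
`I`. -/
lemma quotient [IsNoetherianRing R] (P : Ideal R) [hP : P.IsPrime] (I : Ideal R) (hI : I ≤ P) :
    TorsionDescent P (R ⧸ I) := by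
  induction I using WellFoundedGT.induction with
  | ind I ih =>
    by_cases hass : P ∈ associatedPrimes R (R ⧸ I)
    · obtain ⟨φ, hφ⟩ := ((isAssociatedPrime_iff_exists_injective_linearMap P _).mp hass).2
      exact of_injective hφ
    · obtain ⟨y, hyP, f, hfP, hyf⟩ := exists_mem_colon hass
      have hyI : y ∉ I := fun hy => hfP (hI (by simpa using hyf 1 (by simpa using hy)))
      obtain ⟨d, g, hgP, hT⟩ := ih _ (TorsionTransfer.lt_sup_span hyI)
        (sup_le hI ((Ideal.span_singleton_le_iff_mem P).mpr hyP))
      -- Since `(I : y)/I` is `f`-torsion, `Ext^i` into `R/(I + (y))` only needs degrees `i` and `i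
      -- + 1` of `R/I`. The shift by two leaves room to spare.
      refine ⟨d + 2, f * g, fun h => (hP.mem_or_mem h).elim hfP hgP, ?_⟩
      intro f' hf' L _ _ m hm j hj i hi
      refine hT f' ((Dvd.intro_left _ rfl).trans hf') L m hm (j - 2) (fun i hi => ?_) i (by omega)
      have hker : ExtAnnihilatedUpTo f' 1 L
          (LinearMap.ker (idealFactor (le_colonElement I y))) (i + 2) := by
        refine ExtAnnihilatedUpTo.mono_torsion ((Dvd.intro _ rfl).trans hf')
          (ExtAnnihilatedUpTo.of_pow_smul_right 1 ?_ _)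
        rintro ⟨x, hx⟩
        obtain ⟨x, rfl⟩ := Submodule.Quotient.mk_surjective _ x
        have hx : x ∈ colonElement I y := (Submodule.Quotient.mk_eq_zero _).mp hx
        refine Subtype.ext ?_
        rw [pow_one]
        exact (Submodule.Quotient.mk_eq_zero _).mpr (hyf x hx)
      have hcolon := ExtAnnihilatedUpTo.right (LinearMap.exact_subtype_ker_map _)
        (Submodule.injective_subtype _) (TorsionTransfer.factor_surjective _)
        (hj (i + 1) (by omega)) hker
      have := ExtAnnihilatedUpTo.right (TorsionTransfer.exact_quotientMul I y)
        (TorsionTransfer.quotientMul_injective I y) (TorsionTransfer.factor_surjective _)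
        (hj i (by omega)) hcolon
      simpa using this

lemma self [IsNoetherianRing R] (P : Ideal R) [hP : P.IsPrime] : TorsionDescent P R := by
  obtain ⟨d, f, hf, h⟩ := quotient P ⊥ bot_le
  refine ⟨d, f, hf, fun f' hf' L _ _ m hm j hj => h f' hf' L m hm j fun i hi => ?_⟩
  exact (hj i hi).of_linearEquiv (Submodule.quotEquivOfEqBot (⊥ : Ideal R) rfl).symm

end TorsionDescent

end TorsionTransfer

/-! ### Duality and the `G`-class in short exact sequences. -/

section GClass

variable {R : Type u} [CommRing R]
variable {A B C L L' L'' N : Type u} [AddCommGroup A] [Module R A] [AddCommGroup B] [Module R B]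
  [AddCommGroup C] [Module R C] [AddCommGroup L] [Module R L] [AddCommGroup L'] [Module R L']
  [AddCommGroup L''] [Module R L''] [AddCommGroup N] [Module R N]

/-- `Ext^i_R(L, N) = 0`. -/
abbrev ExtVanishes (R : Type u) [CommRing R] (L N : Type u) [AddCommGroup L] [Module R L]
    [AddCommGroup N] [Module R N] (i : ℕ) : Prop :=
  Subsingleton (Abelian.Ext (ModuleCat.of R L) (ModuleCat.of R N) i)

namespace ExtVanishes

open Abelian

variable {α : L' →ₗ[R] L} {β : L →ₗ[R] L''}

lemma contravariant_left (h : Function.Exact α β) (hα : Function.Injective α)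
    (hβ : Function.Surjective β) {i : ℕ} (hL : ExtVanishes R L N i)
    (hL'' : ExtVanishes R L'' N (i + 1)) : ExtVanishes R L' N i := by
  refine subsingleton_of_forall_eq 0 fun ξ => ?_
  obtain ⟨η, rfl⟩ := Ext.contravariant_sequence_exact₁
    (exactShortComplex_shortExact h hα hβ) (ModuleCat.of R N) ξ (add_comm 1 i)
    (Subsingleton.elim _ _)
  rw [Subsingleton.elim η 0, Ext.comp_zero]

lemma contravariant_middle (h : Function.Exact α β) (hα : Function.Injective α)
    (hβ : Function.Surjective β) {i : ℕ} (hL' : ExtVanishes R L' N i)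
    (hL'' : ExtVanishes R L'' N i) : ExtVanishes R L N i := by
  refine subsingleton_of_forall_eq 0 fun ξ => ?_
  obtain ⟨η, rfl⟩ := Ext.contravariant_sequence_exact₂
    (exactShortComplex_shortExact h hα hβ) (ModuleCat.of R N) ξ (Subsingleton.elim _ _)
  rw [Subsingleton.elim η 0, Ext.comp_zero]

lemma contravariant_right (h : Function.Exact α β) (hα : Function.Injective α)
    (hβ : Function.Surjective β) {i : ℕ} (hL : ExtVanishes R L N (i + 1))
    (hL' : ∀ ξ : Ext (ModuleCat.of R L') (ModuleCat.of R N) i,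
      ∃ η : Ext (ModuleCat.of R L) (ModuleCat.of R N) i,
        (Ext.mk₀ (ModuleCat.ofHom α)).comp η (zero_add i) = ξ) :
    ExtVanishes R L'' N (i + 1) := by
  have hS := exactShortComplex_shortExact h hα hβ
  refine subsingleton_of_forall_eq 0 fun ξ => ?_
  obtain ⟨η, rfl⟩ := Ext.contravariant_sequence_exact₃ hS (ModuleCat.of R N) ξ
    (Subsingleton.elim _ _) (add_comm 1 i)
  obtain ⟨η, rfl⟩ := hL' η
  exact hS.extClass_comp_assoc η

lemma exists_extension (h : Function.Exact α β) (hα : Function.Injective α)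
    (hβ : Function.Surjective β) (hL'' : ExtVanishes R L'' N 1) (θ : L' →ₗ[R] N) :
    ∃ Θ : L →ₗ[R] N, Θ ∘ₗ α = θ := by
  obtain ⟨η, hη⟩ := Ext.contravariant_sequence_exact₁ (exactShortComplex_shortExact h hα hβ)
    (ModuleCat.of R N) (Ext.mk₀ (ModuleCat.ofHom θ)) (add_zero 1) (Subsingleton.elim _ _)
  obtain ⟨Θ, rfl⟩ := (Ext.mk₀_bijective _ _).surjective η
  refine ⟨Θ.hom, ?_⟩
  rw [Ext.mk₀_comp_mk₀] at hη
  have := (Ext.mk₀_bijective _ _).injective hη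
  exact congrArg ModuleCat.Hom.hom this

lemma of_projective [Module.Projective R L] (i : ℕ) : ExtVanishes R L N (i + 1) := by
  have : Projective (ModuleCat.of R L) :=
    (IsProjective.iff_projective (R := R) L).mp inferInstance
  exact Ext.subsingleton_of_projective _ _ i

end ExtVanishes

lemma exists_factorization {φ : A →ₗ[R] B} {ψ : B →ₗ[R] C} (h : Function.Exact φ ψ)
    (hψ : Function.Surjective ψ) (θ : B →ₗ[R] N) (hθ : θ ∘ₗ φ = 0) :
    ∃ Θ : C →ₗ[R] N, Θ ∘ₗ ψ = θ := by
  refine ⟨(LinearMap.ker ψ).liftQ θ ?_ ∘ₗ (ψ.quotKerEquivOfSurjective hψ).symm.toLinearMap, ?_⟩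
  · intro x hx
    obtain ⟨a, rfl⟩ := (h x).mp hx
    exact LinearMap.congr_fun hθ a
  · ext x
    have : (ψ.quotKerEquivOfSurjective hψ).symm (ψ x) = Submodule.Quotient.mk x :=
      (LinearEquiv.symm_apply_eq _).mpr rfl
    simp [this]

lemma dualMap_exact {φ : A →ₗ[R] B} {ψ : B →ₗ[R] C} (h : Function.Exact φ ψ)
    (hψ : Function.Surjective ψ) : Function.Exact ψ.dualMap φ.dualMap := by
  intro θ
  constructor
  · intro hθ
    obtain ⟨Θ, hΘ⟩ := exists_factorization h hψ θ hθ
    exact ⟨Θ, hΘ⟩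
  · rintro ⟨Θ, rfl⟩
    ext x
    simp [h.apply_apply_eq_zero]

/-- The part of the definition of the `G`-class concerning the dual: the biduality map of `N` is
bijective and `Ext^i_R(Hom_R(N, R), R) = 0` for `i > 0`. -/
structure IsExtReflexive (R : Type u) [CommRing R] (N : Type u) [AddCommGroup N] [Module R N] :
    Prop where
  ext_dual : ∀ i : ℕ, ExtVanishes R (Module.Dual R N) R (i + 1)
  biduality : Function.Bijective (Module.Dual.eval R N)

/-- The conditions of the `G`-class without finite generation. -/
structure IsGModule (R : Type u) [CommRing R] (N : Type u) [AddCommGroup N] [Module R N] :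
    Prop extends IsExtReflexive R N where
  ext : ∀ i : ℕ, ExtVanishes R N R (i + 1)

lemma InGClass.isGModule (h : InGClass R N) : IsGModule R N where
  ext_dual i := h.ext_dual_eq_zero (i + 1) i.succ_pos
  biduality := h.biduality
  ext i := h.ext_eq_zero (i + 1) i.succ_pos

lemma eq_zero_of_forall_dual {N : Type u} [AddCommGroup N] [Module R N]
    (h : Function.Injective (Module.Dual.eval R N)) {x : N}
    (hx : ∀ l : Module.Dual R N, l x = 0) : x = 0 :=
  (injective_iff_map_eq_zero _).mp h x (LinearMap.ext hx)

namespace IsExtReflexive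

/-- If every functional on `N` extends along a map `ψ` from `N` to a finite free module, then `ψ` is
injective and its cokernel is again Ext-reflexive. -/
lemma cokernel {F N' : Type u} [AddCommGroup F] [Module R F] [Module.Free R F] [Module.Finite R F]
    [AddCommGroup N'] [Module R N'] {ψ : N →ₗ[R] F} {π : F →ₗ[R] N'} (hN : IsExtReflexive R N)
    (h : Function.Exact ψ π) (hπ : Function.Surjective π)
    (hψ : Function.Surjective ψ.dualMap) : Function.Injective ψ ∧ IsExtReflexive R N' := by
  -- As `F* → N*` is onto, `0 → N'* → F* → N* → 0` is exact, and the claims follow by dualizing it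
  -- again.
  have hπd : Function.Injective π.dualMap := LinearMap.dualMap_injective_of_surjective hπ
  have hex := dualMap_exact h hπ
  refine ⟨?_, ?_, ?_, ?_⟩
  · refine (injective_iff_map_eq_zero _).mpr fun x hx => ?_
    refine eq_zero_of_forall_dual hN.biduality.injective fun l => ?_
    obtain ⟨l, rfl⟩ := hψ l
    simp [hx]
  · exact fun i => ExtVanishes.contravariant_left hex hπd hψ (ExtVanishes.of_projective i)
      (hN.ext_dual (i + 1))
  · refine (injective_iff_map_eq_zero _).mpr fun x hx => ?_
    obtain ⟨v, rfl⟩ := hπ x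
    have hv : ∀ l : Module.Dual R N', l (π v) = 0 := fun l => LinearMap.congr_fun hx l
    -- Evaluation at `v` vanishes on `N'*`, so it factors through `N*` and is evaluation at some `m
    -- ∈ N`.
    obtain ⟨θ, hθ⟩ := exists_factorization hex hψ (Module.Dual.eval R F v)
      (LinearMap.ext fun l => hv l)
    obtain ⟨m, rfl⟩ := hN.biduality.surjective θ
    have : ψ m = v := (Module.bijective_dual_eval R F).injective hθ
    rw [← this, h.apply_apply_eq_zero]
  · intro Θ
    obtain ⟨Θ', hΘ'⟩ := ExtVanishes.exists_extension hex hπd hψ (hN.ext_dual 0) Θ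
    obtain ⟨v, rfl⟩ := (Module.bijective_dual_eval R F).surjective Θ'
    exact ⟨π v, by rw [← hΘ']; rfl⟩

end IsExtReflexive

namespace IsGModule

variable {φ : A →ₗ[R] B} {ψ : B →ₗ[R] C}

lemma kernel (h : Function.Exact φ ψ) (hφ : Function.Injective φ) (hψ : Function.Surjective ψ)
    (hB : IsGModule R B) (hC : IsGModule R C) : IsGModule R A := by
  have hφd : Function.Surjective φ.dualMap :=
    fun θ => ExtVanishes.exists_extension h hφ hψ (hC.ext 0) θ
  have hψd : Function.Injective ψ.dualMap := LinearMap.dualMap_injective_of_surjective hψ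
  have hex := dualMap_exact h hψ
  refine ⟨⟨fun i => ?_, ?_, ?_⟩, fun i => ?_⟩
  · refine ExtVanishes.contravariant_right hex hψd hφd (hB.ext_dual i) fun ξ => ?_
    -- In degree 0, `B** → C**` is onto since `B → C` is and `C` is reflexive.
    obtain _ | i := i
    · obtain ⟨θ, rfl⟩ := (Abelian.Ext.mk₀_bijective _ _).surjective ξ
      obtain ⟨c, hc⟩ := hC.biduality.surjective θ.hom
      obtain ⟨b, rfl⟩ := hψ c
      refine ⟨Abelian.Ext.mk₀ (ModuleCat.ofHom (Module.Dual.eval R B b)), ?_⟩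
      rw [Abelian.Ext.mk₀_comp_mk₀]
      congr 1
      ext l
      exact LinearMap.congr_fun hc l
    · exact ⟨0, @Subsingleton.elim _ (hC.ext_dual i) _ _⟩
  · refine (injective_iff_map_eq_zero _).mpr fun a ha => hφ ?_
    rw [map_zero]
    exact eq_zero_of_forall_dual hB.biduality.injective fun l =>
      LinearMap.congr_fun ha (φ.dualMap l)
  · intro Θ
    obtain ⟨b, hb⟩ := hB.biduality.surjective (Θ ∘ₗ φ.dualMap)
    have hb0 : ψ b = 0 := eq_zero_of_forall_dual hC.biduality.injective fun l => by
      have h1 : l (ψ b) = Θ (φ.dualMap (ψ.dualMap l)) := LinearMap.congr_fun hb (ψ.dualMap l)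
      rw [h1, hex.apply_apply_eq_zero, map_zero]
    obtain ⟨a, rfl⟩ := (h b).mp hb0
    refine ⟨a, LinearMap.ext fun l => ?_⟩
    obtain ⟨l, rfl⟩ := hφd l
    exact LinearMap.congr_fun hb l
  · exact ExtVanishes.contravariant_left h hφ hψ (hB.ext i) (hC.ext (i + 1))

lemma extension (h : Function.Exact φ ψ) (hφ : Function.Injective φ) (hψ : Function.Surjective ψ)
    (hA : IsGModule R A) (hC : IsGModule R C) : IsGModule R B := by
  have hφd : Function.Surjective φ.dualMap :=
    fun θ => ExtVanishes.exists_extension h hφ hψ (hC.ext 0) θ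
  have hψd : Function.Injective ψ.dualMap := LinearMap.dualMap_injective_of_surjective hψ
  have hex := dualMap_exact h hψ
  refine ⟨⟨fun i => ?_, ?_, ?_⟩, fun i => ?_⟩
  · exact ExtVanishes.contravariant_middle hex hψd hφd (hC.ext_dual i) (hA.ext_dual i)
  · refine (injective_iff_map_eq_zero _).mpr fun b hb => ?_
    have hb0 : ψ b = 0 := eq_zero_of_forall_dual hC.biduality.injective fun l =>
      LinearMap.congr_fun hb (ψ.dualMap l)
    obtain ⟨a, rfl⟩ := (h b).mp hb0
    rw [eq_zero_of_forall_dual (R := R) hA.biduality.injective (x := a), map_zero]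
    intro l
    obtain ⟨l, rfl⟩ := hφd l
    exact LinearMap.congr_fun hb l
  · intro Θ
    obtain ⟨c, hc⟩ := hC.biduality.surjective (Θ ∘ₗ ψ.dualMap)
    obtain ⟨b, rfl⟩ := hψ c
    obtain ⟨Φ, hΦ⟩ := exists_factorization hex hφd (Θ - Module.Dual.eval R B b) (by
      ext l
      have : l (ψ b) = Θ (ψ.dualMap l) := LinearMap.congr_fun hc l
      simp [← this])
    obtain ⟨a, rfl⟩ := hA.biduality.surjective Φ
    refine ⟨b + φ a, LinearMap.ext fun l => ?_⟩
    have : l (φ a) = Θ l - l b := LinearMap.congr_fun hΦ l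
    simp [this]
  · exact ExtVanishes.contravariant_middle h hφ hψ (hA.ext i) (hC.ext i)

lemma of_free [Module.Free R A] [Module.Finite R A] : IsGModule R A where
  ext_dual i := ExtVanishes.of_projective i
  biduality := Module.bijective_dual_eval R A
  ext i := ExtVanishes.of_projective i

lemma of_subsingleton [Subsingleton A] : IsGModule R A :=
  of_free

lemma of_linearEquiv (e : A ≃ₗ[R] B) (hA : IsGModule R A) : IsGModule R B :=
  extension (φ := e.toLinearMap) (ψ := (0 : B →ₗ[R] PUnit.{u + 1}))
    (fun b => ⟨fun _ => e.surjective b, fun _ => rfl⟩) e.injective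
    (fun _ => ⟨0, Subsingleton.elim _ _⟩) hA of_subsingleton

end IsGModule

/-! ### Gorenstein dimension at most `n` and syzygies. -/

/-- The existence of an exact sequence `0 → Gₙ → ⋯ → G₀ → M → 0` of modules `Gₗ` satisfying
`IsGModule`. -/
def GDimLE (R : Type u) [CommRing R] : ℕ → ModuleCat.{u} R → Prop
  | 0, M => IsGModule R M
  | n + 1, M => ∃ (K G : ModuleCat.{u} R) (φ : K →ₗ[R] G) (ψ : G →ₗ[R] M),
      Function.Injective φ ∧ Function.Exact φ ψ ∧ Function.Surjective ψ ∧ IsGModule R G ∧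
        GDimLE R n K

namespace GDimLE

lemma of_isGModule {M : ModuleCat.{u} R} (hM : IsGModule R M) (n : ℕ) : GDimLE R n M := by
  cases n with
  | zero => exact hM
  | succ n =>
    induction n generalizing M with
    | zero =>
      refine ⟨ModuleCat.of R PUnit, M, 0, LinearMap.id, fun _ _ _ => rfl, ?_,
        Function.surjective_id, hM, IsGModule.of_subsingleton⟩
      exact fun x => ⟨fun hx => ⟨0, hx.symm⟩, fun ⟨_, hx⟩ => hx.symm⟩
    | succ n ih =>
      refine ⟨ModuleCat.of R PUnit, M, 0, LinearMap.id, fun _ _ _ => rfl, ?_,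
        Function.surjective_id, hM, ih IsGModule.of_subsingleton⟩
      exact fun x => ⟨fun hx => ⟨0, hx.symm⟩, fun ⟨_, hx⟩ => hx.symm⟩

lemma succ {n : ℕ} {M : ModuleCat.{u} R} (hM : GDimLE R n M) : GDimLE R (n + 1) M := by
  induction n generalizing M with
  | zero => exact of_isGModule hM 1
  | succ n ih =>
    obtain ⟨K, G, φ, ψ, hφ, h, hψ, hG, hK⟩ := hM
    exact ⟨K, G, φ, ψ, hφ, h, hψ, hG, ih hK⟩

lemma mono {m n : ℕ} (hmn : m ≤ n) {M : ModuleCat.{u} R} (hM : GDimLE R m M) : GDimLE R n M := by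
  induction hmn with
  | refl => exact hM
  | step _ ih => exact succ ih

/-- The kernel of a surjection onto a `G`-module. -/
lemma kernel {n : ℕ} {φ : A →ₗ[R] B} {ψ : B →ₗ[R] C} (h : Function.Exact φ ψ)
    (hφ : Function.Injective φ) (hψ : Function.Surjective ψ) (hB : GDimLE R n (ModuleCat.of R B))
    (hC : IsGModule R C) : GDimLE R n (ModuleCat.of R A) := by
  cases n with
  | zero => exact IsGModule.kernel h hφ hψ hB hC
  | succ n =>
    obtain ⟨K, G, α, β, hα, hαβ, hβ, hG, hK⟩ := hB
    let β' : G →ₗ[R] B := β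
    have hker : ∀ x : LinearMap.ker (ψ ∘ₗ β'), β' x ∈ LinearMap.range φ := fun x =>
      (h _).mp x.2
    let e := LinearEquiv.ofInjective φ hφ
    let γ : LinearMap.ker (ψ ∘ₗ β') →ₗ[R] A :=
      e.symm.toLinearMap ∘ₗ (β' ∘ₗ Submodule.subtype _).codRestrict _ hker
    have hγ : ∀ x, φ (γ x) = β' x := fun x => by
      have : e (γ x) = ⟨β' x, hker x⟩ := e.apply_symm_apply _
      exact congrArg Subtype.val this
    have hα0 : ∀ k : K, α k ∈ LinearMap.ker (ψ ∘ₗ β') := fun k => by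
      have : β' (α k) = 0 := hαβ.apply_apply_eq_zero k
      simp [this]
    -- The kernel of `G → B → C` is a `G`-module mapping onto `A`, still with kernel `K`.
    refine ⟨K, ModuleCat.of R (LinearMap.ker (ψ ∘ₗ β')), α.codRestrict _ hα0, γ, ?_, ?_, ?_, ?_, hK⟩
    · intro x y hxy
      exact hα (congrArg Subtype.val hxy)
    · intro x
      constructor
      · intro hx
        have : β' x = 0 := by rw [← hγ, hx, map_zero]
        obtain ⟨k, hk⟩ := (hαβ _).mp this
        exact ⟨k, Subtype.ext hk⟩
      · rintro ⟨k, rfl⟩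
        apply hφ
        rw [hγ, map_zero]
        exact hαβ.apply_apply_eq_zero k
    · intro a
      obtain ⟨g, hg⟩ := hβ (φ a)
      have hg' : β' g = φ a := hg
      refine ⟨⟨g, ?_⟩, hφ ?_⟩
      · simp [hg', h.apply_apply_eq_zero]
      · rw [hγ]
        exact hg'
    · exact IsGModule.kernel (LinearMap.exact_subtype_ker_map (ψ ∘ₗ β'))
        (Submodule.injective_subtype _) (hψ.comp hβ) hG hC

/-- Extensions of a finite free module. -/
lemma extension_free {n : ℕ} {P : Type u} [AddCommGroup P] [Module R P] [Module.Free R P]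
    [Module.Finite R P] {φ : A →ₗ[R] B} {ψ : B →ₗ[R] P} (h : Function.Exact φ ψ)
    (hφ : Function.Injective φ) (hψ : Function.Surjective ψ) (hA : GDimLE R n (ModuleCat.of R A)) :
    GDimLE R n (ModuleCat.of R B) := by
  cases n with
  | zero => exact IsGModule.extension h hφ hψ hA IsGModule.of_free
  | succ n =>
    obtain ⟨K, G, α, β, hα, hαβ, hβ, hG, hK⟩ := hA
    let β' : G →ₗ[R] A := β
    obtain ⟨σ, hσ⟩ := Module.projective_lifting_property ψ LinearMap.id hψ
    have hσ' : ∀ p, ψ (σ p) = p := LinearMap.congr_fun hσ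
    refine ⟨K, ModuleCat.of R (G × P), LinearMap.inl R G P ∘ₗ α, (φ ∘ₗ β').coprod σ, ?_, ?_, ?_, ?_,
      hK⟩
    · exact LinearMap.inl_injective.comp hα
    · rintro ⟨g, p⟩
      constructor
      · intro hx
        have hx : φ (β' g) + σ p = 0 := hx
        have hp : p = 0 := by
          have := congrArg ψ hx
          rwa [map_add, h.apply_apply_eq_zero, hσ', zero_add, map_zero] at this
        subst hp
        rw [map_zero, add_zero] at hx
        obtain ⟨k, rfl⟩ := (hαβ g).mp (hφ (hx.trans (map_zero φ).symm))
        exact ⟨k, rfl⟩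
      · rintro ⟨k, hk⟩
        obtain ⟨rfl, rfl⟩ := Prod.mk.inj hk
        have : β' (α k) = 0 := hαβ.apply_apply_eq_zero k
        change φ (β' (α k)) + σ 0 = 0
        rw [this, map_zero, map_zero, add_zero]
    · intro b
      obtain ⟨a, ha⟩ := (h (b - σ (ψ b))).mp (by rw [map_sub, hσ', sub_self])
      obtain ⟨g, rfl⟩ := hβ a
      refine ⟨(g, ψ b), ?_⟩
      change φ (β' g) + σ (ψ b) = b
      have ha : φ (β' g) = b - σ (ψ b) := ha
      rw [ha, sub_add_cancel]
    · exact IsGModule.extension (φ := LinearMap.inl R G P) (ψ := LinearMap.snd R G P)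
        (Function.Exact.inl_snd) LinearMap.inl_injective LinearMap.snd_surjective
        hG IsGModule.of_free

/-- The first syzygy with respect to a finite free module. -/
lemma syzygy {n : ℕ} {P : Type u} [AddCommGroup P] [Module R P] [Module.Free R P]
    [Module.Finite R P] {φ : A →ₗ[R] P} {ψ : P →ₗ[R] C} (h : Function.Exact φ ψ)
    (hφ : Function.Injective φ) (hψ : Function.Surjective ψ)
    (hC : GDimLE R n (ModuleCat.of R C)) : GDimLE R (n - 1) (ModuleCat.of R A) := by
  cases n with
  | zero => exact IsGModule.kernel h hφ hψ IsGModule.of_free hC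
  | succ n =>
    obtain ⟨K, G, α, β, hα, hαβ, hβ, hG, hK⟩ := hC
    let β' : G →ₗ[R] C := β
    -- The pullback of `G` and `P` over `C`: its projection to `P` has kernel `K`, and its
    -- projection to `G` has kernel `A`.
    let E := LinearMap.eqLocus (β' ∘ₗ LinearMap.fst R G P) (ψ ∘ₗ LinearMap.snd R G P)
    have hE : ∀ x : E, β' x.1.1 = ψ x.1.2 := fun x => x.2
    let ι : K →ₗ[R] E := (LinearMap.inl R G P ∘ₗ α).codRestrict E fun k => by
      change β' (α k) = ψ 0
      rw [map_zero]
      exact hαβ.apply_apply_eq_zero k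
    let κ : A →ₗ[R] E := (LinearMap.inr R G P ∘ₗ φ).codRestrict E fun a => by
      change β' 0 = ψ (φ a)
      rw [map_zero, h.apply_apply_eq_zero]
    have hEn : GDimLE R n (ModuleCat.of R E) := by
      refine extension_free (A := K) (φ := ι) (ψ := LinearMap.snd R G P ∘ₗ E.subtype) ?_ ?_ ?_ hK
      · rintro ⟨⟨g, p⟩, hx⟩
        constructor
        · intro hp
          have hp : p = 0 := hp
          subst hp
          have hg : β' g = 0 := (hE ⟨⟨g, 0⟩, hx⟩).trans (map_zero ψ)
          obtain ⟨k, rfl⟩ := (hαβ g).mp hg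
          exact ⟨k, rfl⟩
        · rintro ⟨k, hk⟩
          exact (congrArg (fun z : E => z.1.2) hk).symm
      · intro x y hxy
        exact hα (congrArg (fun z : E => z.1.1) hxy)
      · intro p
        obtain ⟨g, hg⟩ := hβ (ψ p)
        exact ⟨⟨⟨g, p⟩, hg⟩, rfl⟩
    refine kernel (φ := κ) (ψ := LinearMap.fst R G P ∘ₗ E.subtype) ?_ ?_ ?_ hEn hG
    · rintro ⟨⟨g, p⟩, hx⟩
      constructor
      · intro hg
        have hg : g = 0 := hg
        subst hg
        have hp : ψ p = 0 := (hE ⟨⟨0, p⟩, hx⟩).symm.trans (map_zero β')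
        obtain ⟨a, rfl⟩ := (h p).mp hp
        exact ⟨a, rfl⟩
      · rintro ⟨a, ha⟩
        exact (congrArg (fun z : E => z.1.1) ha).symm
    · intro x y hxy
      exact hφ (congrArg (fun z : E => z.1.2) hxy)
    · intro g
      obtain ⟨p, hp⟩ := hψ (β' g)
      exact ⟨⟨⟨g, p⟩, hp.symm⟩, rfl⟩

end GDimLE

end GClass

/-! ### Reading off `gDim` and supports. -/

section GDimension

variable {R : Type u} [CommRing R]

lemma GResolution.gDimLE {n : ℕ} {M : Type u} [AddCommGroup M] [Module R M] (G : GResolution R M)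
    (hn : ∀ l, n < l → Subsingleton (G.obj l)) : GDimLE R n (ModuleCat.of R M) := by
  induction n generalizing M with
  | zero =>
    have := hn 1 zero_lt_one
    refine IsGModule.of_linearEquiv (LinearEquiv.ofBijective G.augmentation
      ⟨(injective_iff_map_eq_zero _).mpr fun x hx => ?_, G.augmentation_surjective⟩)
      (G.inGClass 0).isGModule
    obtain ⟨y, rfl⟩ := (G.exact_zero x).mp hx
    rw [Subsingleton.elim y 0, map_zero]
  | succ n ih =>
    refine ⟨ModuleCat.of R (LinearMap.ker G.augmentation), G.obj 0, Submodule.subtype _,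
      G.augmentation, Submodule.injective_subtype _, LinearMap.exact_subtype_ker_map _,
      G.augmentation_surjective, (G.inGClass 0).isGModule, ?_⟩
    refine ih ⟨fun l => G.obj (l + 1), fun l => G.inGClass (l + 1), fun l => G.d (l + 1),
      (G.d 0).codRestrict _ fun x => G.exact_zero.apply_apply_eq_zero x, ?_, ?_,
      fun l => G.exact_succ (l + 1)⟩ fun l hl => hn (l + 1) (Nat.succ_lt_succ hl)
    · rintro ⟨x, hx⟩
      obtain ⟨y, hy⟩ := (G.exact_zero x).mp hx
      exact ⟨y, Subtype.ext hy⟩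
    · intro x
      rw [← G.exact_succ 0 x]
      exact ⟨fun h => congrArg Subtype.val h, fun h => Subtype.ext h⟩

lemma gDimLE_of_gDim_le {M : Type u} [AddCommGroup M] [Module R M] {t : ℕ}
    (h : ¬ toExtended (t : WithBot ℕ) < gDim R M) : GDimLE R t (ModuleCat.of R M) := by
  by_cases hM : Subsingleton M
  · exact GDimLE.of_isGModule (M := ModuleCat.of R M) (IsGModule.of_subsingleton (A := M)) t
  · rw [gDim, if_neg hM, not_lt] at h
    -- A strict bound on the infimum yields an actual resolution.
    have h' : (⨅ (n : ℕ) (_ : ∃ G : GResolution R M, G.HasLength n), (n : ℕ∞)) < (t + 1 : ℕ) := by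
      refine lt_of_le_of_lt (WithBot.coe_le_coe.mp h) ?_
      change ((t : ℕ) : ℕ∞) < ((t + 1 : ℕ) : ℕ∞)
      exact_mod_cast t.lt_succ_self
    obtain ⟨n, h'⟩ := iInf_lt_iff.mp h'
    obtain ⟨⟨G, -, hG⟩, h'⟩ := iInf_lt_iff.mp h'
    exact (G.gDimLE hG).mono (Nat.lt_succ_iff.mp (by exact_mod_cast h'))

lemma subsingleton_of_gDim_le_bot {M : Type u} [AddCommGroup M] [Module R M]
    (h : ¬ toExtended ⊥ < gDim R M) : Subsingleton M := by
  by_contra hM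
  rw [gDim, if_neg hM] at h
  exact h (WithBot.bot_lt_coe _)

lemma exists_pow_smul_eq_zero_of_forall_subsingleton {N : Type u} [AddCommGroup N] [Module R N]
    [Module.Finite R N] {x : R} (h : ∀ p : PrimeSpectrum R, x ∉ p.asIdeal →
      Subsingleton (LocalizedModule p.asIdeal.primeCompl N)) :
    ∃ e : ℕ, ∀ y : N, x ^ e • y = 0 := by
  have hx : x ∈ (Module.annihilator R N).radical := by
    rw [Ideal.radical_eq_sInf, Ideal.mem_sInf]
    rintro p ⟨hle, hp⟩
    by_contra hxp
    have hsupp : (⟨p, hp⟩ : PrimeSpectrum R) ∈ Module.support R N := by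
      rw [Module.support_eq_zeroLocus]
      exact hle
    exact (Module.notMem_support_iff.mpr (h ⟨p, hp⟩ hxp)) hsupp
  obtain ⟨e, he⟩ := hx
  exact ⟨e, fun y => Module.mem_annihilator.mp he y⟩

end GDimension

/-! ### Cosyzygies away from `x`. -/

section Localization

variable {R : Type u} [CommRing R] [IsNoetherianRing R]

variable {N F N' : Type u} [AddCommGroup N] [Module R N] [AddCommGroup F] [Module R F]
  [AddCommGroup N'] [Module R N']

/-- `N` is finitely presented, so a functional on `S⁻¹N` is a fraction of one on `N`, which extends
along `ψ`. -/
lemma dualMap_localizedModule_map_surjective [Module.Finite R N] (S : Submonoid R)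
    {ψ : N →ₗ[R] F} (hψ : Function.Surjective ψ.dualMap) :
    Function.Surjective (LocalizedModule.map S ψ).dualMap := by
  intro l
  have : Module.FinitePresentation R N := Module.finitePresentation_of_finite R N
  let l₀ : N →ₗ[R] Localization S := l.restrictScalars R ∘ₗ LocalizedModule.mkLinearMap S N
  obtain ⟨h, s, hs⟩ := Module.FinitePresentation.exists_lift_of_isLocalizedModule S
    (Algebra.linearMap R (Localization S)) l₀
  obtain ⟨m, rfl⟩ := hψ h
  let m' : LocalizedModule S F →ₗ[Localization S] Localization S :=
    LinearMap.extendScalarsOfIsLocalization S (Localization S)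
      (IsLocalizedModule.lift S (LocalizedModule.mkLinearMap S F)
        (Algebra.linearMap R (Localization S) ∘ₗ m)
        (IsLocalizedModule.map_units (Algebra.linearMap R (Localization S))))
  refine ⟨IsLocalization.mk' (Localization S) 1 s • m', ?_⟩
  have key : ∀ y : N, IsLocalization.mk' (Localization S) 1 s • algebraMap R (Localization S)
      (m (ψ y)) = l (LocalizedModule.mkLinearMap S N y) := by
    intro y
    have := LinearMap.congr_fun hs y
    have h2 : algebraMap R (Localization S) (m (ψ y)) =
        algebraMap R (Localization S) s * l (LocalizedModule.mkLinearMap S N y) := by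
      rw [← Algebra.smul_def]
      exact this
    rw [h2, smul_eq_mul, ← mul_assoc, mul_comm (IsLocalization.mk' _ _ _),
      IsLocalization.mul_mk'_eq_mk'_of_mul, mul_one, IsLocalization.mk'_self', one_mul]
  apply LinearMap.restrictScalars_injective R
  refine IsLocalizedModule.linearMap_ext S (LocalizedModule.mkLinearMap S N)
    (Algebra.linearMap R (Localization S)) ?_
  ext y
  rw [LinearMap.comp_apply, LinearMap.comp_apply, LinearMap.restrictScalars_apply,
    LinearMap.restrictScalars_apply, ← key]
  change IsLocalization.mk' (Localization S) 1 s • m' (LocalizedModule.map S ψ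
    (LocalizedModule.mkLinearMap S N y)) = _
  congr 1
  have h1 : LocalizedModule.map S ψ (LocalizedModule.mkLinearMap S N y) =
      LocalizedModule.mkLinearMap S F (ψ y) :=
    IsLocalizedModule.map_apply S (LocalizedModule.mkLinearMap S N)
      (LocalizedModule.mkLinearMap S F) ψ y
  rw [h1]
  exact IsLocalizedModule.lift_apply S _ _
    (IsLocalizedModule.map_units (Algebra.linearMap R (Localization S))) _

/-- `N_p` is Ext-reflexive over `R_p` for all primes `p` not containing `x`. -/
def IsExtReflexiveAwayFrom (x : R) (N : Type u) [AddCommGroup N] [Module R N] : Prop :=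
  ∀ p : PrimeSpectrum R, x ∉ p.asIdeal → IsExtReflexive (Localization.AtPrime p.asIdeal)
    (LocalizedModule p.asIdeal.primeCompl N)

lemma exists_dualMap_surjective (N : Type u) [AddCommGroup N] [Module R N] [Module.Finite R N] :
    ∃ (n : ℕ) (ψ : N →ₗ[R] (Fin n → R)), Function.Surjective ψ.dualMap := by
  have : Module.Finite R (Module.Dual R N) := inferInstance
  obtain ⟨n, g, hg⟩ := Module.Finite.exists_fin (R := R) (M := Module.Dual R N)
  refine ⟨n, LinearMap.pi g, fun l => ?_⟩
  have hl : l ∈ Submodule.span R (Set.range g) := hg ▸ Submodule.mem_top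
  obtain ⟨c, rfl⟩ := (Submodule.mem_span_range_iff_exists_fun R).mp hl
  refine ⟨∑ i, c i • LinearMap.proj i, ?_⟩
  ext y
  simp

/-- A single global `ψ` serves all primes at once, because surjectivity of its dual map localizes.
Its kernel vanishes at each `p` not containing `x`. -/
lemma IsExtReflexiveAwayFrom.exists_cosyzygy {x : R} [Module.Finite R N]
    (hN : IsExtReflexiveAwayFrom x N) : ∃ (n : ℕ) (ψ : N →ₗ[R] (Fin n → R)) (e : ℕ),
      (∀ y : LinearMap.ker ψ, x ^ e • y = 0) ∧
        IsExtReflexiveAwayFrom x ((Fin n → R) ⧸ LinearMap.range ψ) := by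
  obtain ⟨n, ψ, hψ⟩ := exists_dualMap_surjective (R := R) N
  have key : ∀ p : PrimeSpectrum R, x ∉ p.asIdeal →
      Function.Injective (LocalizedModule.map p.asIdeal.primeCompl ψ) ∧
      IsExtReflexive (Localization.AtPrime p.asIdeal)
        (LocalizedModule p.asIdeal.primeCompl ((Fin n → R) ⧸ LinearMap.range ψ)) := by
    intro p hp
    have : Module.Free (Localization.AtPrime p.asIdeal)
        (LocalizedModule p.asIdeal.primeCompl (Fin n → R)) :=
      Module.free_of_isLocalizedModule p.asIdeal.primeCompl
        (LocalizedModule.mkLinearMap p.asIdeal.primeCompl (Fin n → R))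
    exact (hN p hp).cokernel
      (ψ := LocalizedModule.map p.asIdeal.primeCompl ψ)
      (π := LocalizedModule.map p.asIdeal.primeCompl (LinearMap.range ψ).mkQ)
      (LocalizedModule.map_exact p.asIdeal.primeCompl ψ (LinearMap.range ψ).mkQ
        (LinearMap.exact_map_mkQ_range ψ))
      (LocalizedModule.map_surjective p.asIdeal.primeCompl _ (Submodule.mkQ_surjective _))
      (dualMap_localizedModule_map_surjective p.asIdeal.primeCompl hψ)
  obtain ⟨e, he⟩ := exists_pow_smul_eq_zero_of_forall_subsingleton (N := LinearMap.ker ψ) (x := x)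
    fun p hp => by
      have hex : Function.Exact
          (LocalizedModule.map p.asIdeal.primeCompl (LinearMap.ker ψ).subtype)
          (LocalizedModule.map p.asIdeal.primeCompl ψ) :=
        LocalizedModule.map_exact p.asIdeal.primeCompl _ _ (LinearMap.exact_subtype_ker_map ψ)
      have hinj := LocalizedModule.map_injective p.asIdeal.primeCompl (LinearMap.ker ψ).subtype
        (Submodule.injective_subtype _)
      refine subsingleton_of_forall_eq 0 fun z => hinj ((key p hp).1 ?_)
      rw [hex.apply_apply_eq_zero, map_zero, map_zero]
  exact ⟨n, ψ, e, he, fun p hp => (key p hp).2⟩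

/-- Iterated cosyzygies reduce `Ext^j(L, N)` to `Ext^{j-d}(L, N')`, up to a power of `x` which does
not depend on `L` and `j`. -/
lemma IsExtReflexiveAwayFrom.exists_iterated_cosyzygy {x : R} (d : ℕ) :
    ∀ {N : Type u} [AddCommGroup N] [Module R N] [Module.Finite R N],
      IsExtReflexiveAwayFrom x N → ∃ (E : ℕ) (N' : ModuleCat.{u} R) (_ : Module.Finite R N'),
        ∀ (f : R) (L : Type u) [AddCommGroup L] [Module R L] (j : ℕ),
          (∀ i ≤ j, ExtAnnihilatedUpTo f 1 L R i) →
          (∀ i, i + d = j → ExtAnnihilatedUpTo f 1 L N' i) →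
            ExtAnnihilatedUpTo f (x ^ E) L N j := by
  induction d with
  | zero =>
    intro N _ _ _ _
    exact ⟨0, ModuleCat.of R N, inferInstance, fun f L _ _ j _ h => by
      rw [pow_zero]
      exact h j rfl⟩
  | succ d ih =>
    intro N _ _ _ hN
    obtain ⟨n, ψ, e, he, hN₁⟩ := hN.exists_cosyzygy
    obtain ⟨E, N', hN', h⟩ := ih hN₁
    refine ⟨e + E, N', hN', fun f L _ _ j hj hd => ?_⟩
    -- Passing from the cokernel to the range of `ψ` costs nothing, and only `ker ψ` contributes `x
    -- ^ e`. For `j ≤ d` the condition on `N'` is vacuous.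
    have hrange := ExtAnnihilatedUpTo.left (f := f) (w₁ := x ^ E) (w₂ := 1) (L := L) (i := j)
      (φ := (LinearMap.range ψ).subtype) (ψ := (LinearMap.range ψ).mkQ)
      (LinearMap.exact_subtype_mkQ _) (Submodule.injective_subtype _)
      (Submodule.mkQ_surjective _)
      (fun i hi => h f L i (fun k hk => hj k (by omega)) fun k hk => hd k (by omega))
      ((hj j le_rfl).pi_of_self n)
    have := ExtAnnihilatedUpTo.middle (f := f) (w₁ := x ^ e) (L := L) (i := j)
      (φ := (LinearMap.ker ψ).subtype) (ψ := ψ.rangeRestrict)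
      (fun y => by
        rw [← LinearMap.exact_subtype_ker_map ψ y]
        exact ⟨fun h => congrArg Subtype.val h, fun h => Subtype.ext h⟩)
      (Submodule.injective_subtype _) ψ.surjective_rangeRestrict
      (ExtAnnihilatedUpTo.of_smul_right he j) hrange
    simpa [pow_add] using this

end Localization

/-! ### A uniform exponent by Noetherian induction. -/

section UniformAnnihilation

variable {R : Type u} [CommRing R]

/-- If `Ext^j(L, N)` is annihilated by `w` up to `f`-torsion, and `v` annihilates the relevant `Ext`
modules of the kernels and cokernels of the powers of `f` on `L`, then `v * v * w` annihilates
`Ext^j(L, N)`. -/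
lemma ExtAnnihilatedUpTo.of_kernel_of_cokernel {L N : Type u} [AddCommGroup L] [Module R L]
    [AddCommGroup N] [Module R N] {f v w : R} {j : ℕ} (h : ExtAnnihilatedUpTo f w L N j)
    (hker : ∀ s i, i + 1 = j →
      ExtAnnihilatedUpTo 1 v (LinearMap.ker (LinearMap.lsmul R L (f ^ s))) N i)
    (hcoker : ∀ s, ExtAnnihilatedUpTo 1 v (L ⧸ LinearMap.range (LinearMap.lsmul R L (f ^ s))) N j) :
    ExtAnnihilatedUpTo 1 (v * v * w) L N j := by
  intro ξ
  obtain ⟨s, hs⟩ := h ξ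
  let μ := LinearMap.lsmul R L (f ^ s)
  have hS₁ := exactShortComplex_shortExact (φ := (LinearMap.ker μ).subtype) (ψ := μ.rangeRestrict)
    (fun y => by
      rw [← LinearMap.exact_subtype_ker_map μ y]
      exact ⟨fun h => congrArg Subtype.val h, fun h => Subtype.ext h⟩)
    (Submodule.injective_subtype _) μ.surjective_rangeRestrict
  have hS₂ := exactShortComplex_shortExact (φ := (LinearMap.range μ).subtype)
    (ψ := (LinearMap.range μ).mkQ) (LinearMap.exact_subtype_mkQ _) (Submodule.injective_subtype _)
    (Submodule.mkQ_surjective _)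
  -- The restriction of `w • ξ` to `f ^ s L`. Its pullback along `L → f ^ s L` is `f ^ s * w • ξ =
  -- 0`, so `ζ` comes from the kernel of `f ^ s`. Once `v` kills `ζ`, `v • w • ξ` comes from the
  -- cokernel.
  let ζ := (Abelian.Ext.mk₀ (ModuleCat.ofHom (LinearMap.range μ).subtype)).comp (w • ξ) (zero_add j)
  have hζ : (Abelian.Ext.mk₀ (ModuleCat.ofHom μ.rangeRestrict)).comp ζ (zero_add j) = 0 := by
    have hμ : ModuleCat.ofHom μ.rangeRestrict ≫ ModuleCat.ofHom (LinearMap.range μ).subtype =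
        f ^ s • 𝟙 (ModuleCat.of R L) := by
      ext y
      rfl
    rw [Abelian.Ext.mk₀_comp_mk₀_assoc, hμ, ← ExtAnnihilatedUpTo.smul_eq_mk₀_comp, smul_smul, hs]
  have hvζ : v • ζ = 0 := by
    obtain _ | i := j
    · have : Epi (ModuleCat.ofHom μ.rangeRestrict) :=
        (ModuleCat.epi_iff_surjective _).mpr μ.surjective_rangeRestrict
      have hζ0 : ζ = 0 := Abelian.Ext.precomp_mk₀_injective_of_epi (ModuleCat.of R N)
        (ModuleCat.ofHom μ.rangeRestrict) (by simpa using hζ)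
      rw [hζ0, smul_zero]
    · obtain ⟨η, hη⟩ := Abelian.Ext.contravariant_sequence_exact₃ hS₁ (ModuleCat.of R N) ζ hζ
        (add_comm 1 i)
      rw [← hη, ← Abelian.Ext.comp_smul, (hker s i rfl).smul_eq_zero η, Abelian.Ext.comp_zero]
  obtain ⟨θ, hθ⟩ := Abelian.Ext.contravariant_sequence_exact₂ hS₂ (ModuleCat.of R N) (v • w • ξ)
    (by rw [Abelian.Ext.comp_smul]; exact hvζ)
  refine ⟨0, ?_⟩
  rw [pow_zero, one_mul, mul_assoc, mul_smul, mul_smul, ← hθ, ← Abelian.Ext.comp_smul,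
    (hcoker s).smul_eq_zero θ, Abelian.Ext.comp_zero]

/-- `Ext^i(L, R) = 0` for all `i ≤ j` and all finitely generated `a`-power torsion modules `L`, that
is, `grade(a, R) > j`. -/
def ExtVanishesThrough (a : Ideal R) (j : ℕ) : Prop :=
  ∀ (L : Type u) [AddCommGroup L] [Module R L] [Module.Finite R L] (n : ℕ),
    a ^ n ≤ Module.annihilator R L → ∀ i ≤ j, ExtVanishes R L R i

lemma ExtVanishesThrough.mono {a : Ideal R} {i j : ℕ} (hij : i ≤ j) (h : ExtVanishesThrough a j) :
    ExtVanishesThrough a i :=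
  fun L _ _ _ n hn k hk => h L n hn k (hk.trans hij)

lemma pow_le_annihilator_submodule {a : Ideal R} {n : ℕ} {L : Type u} [AddCommGroup L] [Module R L]
    (h : a ^ n ≤ Module.annihilator R L) (K : Submodule R L) :
    a ^ n ≤ Module.annihilator R K :=
  h.trans (LinearMap.annihilator_le_of_injective K.subtype K.injective_subtype)

lemma pow_le_annihilator_quotient {a : Ideal R} {n : ℕ} {L : Type u} [AddCommGroup L] [Module R L]
    (h : a ^ n ≤ Module.annihilator R L) (K : Submodule R L) :
    a ^ n ≤ Module.annihilator R (L ⧸ K) :=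
  h.trans (LinearMap.annihilator_le_of_surjective K.mkQ K.mkQ_surjective)

/-- A power of `x` annihilates the modules `Ext^j(L, N)` for all `a` with `grade(a, R) > j` and all
finitely generated `L` which are both `a`-power torsion and `b`-power torsion. -/
def UniformlyAnnihilated (x : R) (N : Type u) [AddCommGroup N] [Module R N] (b : Ideal R) : Prop :=
  ∃ k : ℕ, ∀ (a : Ideal R) (j : ℕ), ExtVanishesThrough a j →
    ∀ (L : Type u) [AddCommGroup L] [Module R L] [Module.Finite R L] (n m : ℕ),
      a ^ n ≤ Module.annihilator R L → b ^ m ≤ Module.annihilator R L →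
        ExtAnnihilatedUpTo 1 (x ^ k) L N j

variable [IsNoetherianRing R] {x : R} {N : Type u} [AddCommGroup N] [Module R N]

/-- Filter `L` by `b₁ ^ m L`, which `b₂ ^ m` kills, with quotient killed by `b₁ ^ m`. -/
lemma UniformlyAnnihilated.of_mul_le {b b₁ b₂ : Ideal R} (hb : b₁ * b₂ ≤ b)
    (h₁ : UniformlyAnnihilated x N b₁) (h₂ : UniformlyAnnihilated x N b₂) :
    UniformlyAnnihilated x N b := by
  obtain ⟨k₁, h₁⟩ := h₁
  obtain ⟨k₂, h₂⟩ := h₂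
  refine ⟨k₂ + k₁, fun a j ha L _ _ _ n m hn hm => ?_⟩
  let K : Submodule R L := b₁ ^ m • ⊤
  have hK : b₂ ^ m ≤ Module.annihilator R K := by
    intro y hy
    rw [Module.mem_annihilator]
    rintro ⟨z, hz⟩
    refine Subtype.ext ?_
    change y • z = 0
    induction hz using Submodule.smul_induction_on' with
    | smul r hr l _ =>
      rw [smul_smul]
      refine Module.mem_annihilator.mp (hm (Ideal.pow_right_mono hb m ?_)) l
      rw [mul_pow, mul_comm y r]
      exact Ideal.mul_mem_mul hr hy
    | add z₁ _ z₂ _ h₁ h₂ => rw [smul_add, h₁, h₂, add_zero]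
  have hQ : b₁ ^ m ≤ Module.annihilator R (L ⧸ K) := by
    intro y hy
    rw [Module.mem_annihilator]
    intro z
    obtain ⟨z, rfl⟩ := Submodule.Quotient.mk_surjective _ z
    exact (Submodule.Quotient.mk_eq_zero _).mpr (Submodule.smul_mem_smul hy Submodule.mem_top)
  rw [pow_add]
  exact ExtAnnihilatedUpTo.contravariant_middle (LinearMap.exact_subtype_mkQ K)
    K.injective_subtype K.mkQ_surjective
    (h₂ a j ha K n m (pow_le_annihilator_submodule hn K) hK)
    (h₁ a j ha (L ⧸ K) n m (pow_le_annihilator_quotient hn K) hQ)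

/-- The number of cosyzygies is the shift `d` of `TorsionDescent.self P`. Hence `E` depends on
neither `L` nor `j`. -/
lemma IsExtReflexiveAwayFrom.exists_localized_annihilation [Module.Finite R N]
    (hN : IsExtReflexiveAwayFrom x N) (P : Ideal R) [hP : P.IsPrime] :
    ∃ E : ℕ, ∃ f ∉ P, ∀ (L : Type u) [AddCommGroup L] [Module R L] (j m : ℕ),
      P ^ m ≤ Module.annihilator R L → (∀ i ≤ j, ExtVanishes R L R i) →
        ExtAnnihilatedUpTo f (x ^ E) L N j := by
  obtain ⟨d, f, hf, hdesc⟩ := TorsionDescent.self P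
  obtain ⟨E, N', hN', h⟩ := hN.exists_iterated_cosyzygy d
  obtain ⟨g, hg, htrans⟩ := TorsionTransfer.of_finite P N'
  refine ⟨E, f * g, fun hfg => (hP.mem_or_mem hfg).elim hf hg, fun L _ _ j m hm hj => ?_⟩
  have hpow : ∀ y ∈ P, ∀ z : L, y ^ m • z = 0 := fun y hy z =>
    Module.mem_annihilator.mp (hm (Ideal.pow_mem_pow hy m)) z
  have hR : ∀ i ≤ j, ExtAnnihilatedUpTo (f * g) 1 L R i := fun i hi =>
    ExtAnnihilatedUpTo.of_subsingleton (hj i hi)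
  refine h (f * g) L j hR fun i hi => htrans _ (dvd_mul_left g f) L m hpow i fun k hk => ?_
  exact hdesc _ (dvd_mul_right f g) L m hpow j hR k (by omega)

lemma IsExtReflexiveAwayFrom.uniformlyAnnihilated [Module.Finite R N]
    (hN : IsExtReflexiveAwayFrom x N) (b : Ideal R) : UniformlyAnnihilated x N b := by
  induction b using WellFoundedGT.induction with
  | ind b ih =>
    by_cases htop : b = ⊤
    · refine ⟨0, fun a j _ L _ _ _ n m _ hm => ExtAnnihilatedUpTo.of_smul_left (fun z => ?_) j⟩
      rw [htop, Ideal.top_pow] at hm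
      exact Module.mem_annihilator.mp (hm Submodule.mem_top) z
    by_cases hb : b.IsPrime
    · obtain ⟨E, f, hf, hE⟩ := hN.exists_localized_annihilation b
      obtain ⟨k, hk⟩ := ih _ (TorsionTransfer.lt_sup_span hf)
      refine ⟨k + k + E, fun a j ha L _ _ _ n m hn hm => ?_⟩
      have hann : ∀ (s : ℕ) (K : Type u) [AddCommGroup K] [Module R K],
          b ^ m ≤ Module.annihilator R K → (∀ z : K, f ^ s • z = 0) →
            (b ⊔ Ideal.span {f}) ^ (m + s) ≤ Module.annihilator R K := by
        intro s K _ _ hbK hfK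
        refine Ideal.sup_pow_add_le_pow_sup_pow.trans (sup_le hbK ?_)
        rw [Ideal.span_singleton_pow, Ideal.span_singleton_le_iff_mem]
        exact Module.mem_annihilator.mpr hfK
      rw [pow_add, pow_add]
      -- The kernel and cokernel of `f ^ s` on `L` are killed by a power of `b + (f)`. That power
      -- varies with `s`, but the exponent `k` does not.
      refine (hE L j m hm (ha L n hn)).of_kernel_of_cokernel (fun s i hi => ?_) fun s => ?_
      · refine hk a i (ha.mono (by omega)) _ n (m + s) (pow_le_annihilator_submodule hn _)
          (hann s _ (pow_le_annihilator_submodule hm _) ?_)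
        rintro ⟨z, hz⟩
        exact Subtype.ext hz
      · refine hk a j ha _ n (m + s) (pow_le_annihilator_quotient hn _)
          (hann s _ (pow_le_annihilator_quotient hm _) fun z => ?_)
        obtain ⟨z, rfl⟩ := Submodule.Quotient.mk_surjective _ z
        exact (Submodule.Quotient.mk_eq_zero _).mpr ⟨z, rfl⟩
    · obtain ⟨u, hu, v, hv, huv⟩ := (Ideal.not_isPrime_iff.mp hb).resolve_left htop
      refine UniformlyAnnihilated.of_mul_le ?_ (ih _ (TorsionTransfer.lt_sup_span hu))
        (ih _ (TorsionTransfer.lt_sup_span hv))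
      rw [Ideal.sup_mul, Ideal.mul_sup]
      refine sup_le (sup_le Ideal.mul_le_right Ideal.mul_le_left) ?_
      rw [Ideal.mul_sup, Ideal.span_singleton_mul_span_singleton]
      exact sup_le Ideal.mul_le_right ((Ideal.span_singleton_le_iff_mem b).mpr huv)

/-- If `N_p` is Ext-reflexive for all `p` not containing `x`, then some power of `x` annihilates
`Ext^j(L, N)` for all `a` with `grade(a, R) > j` and all finitely generated `a`-power torsion
modules `L`. -/
lemma IsExtReflexiveAwayFrom.exists_pow_annihilates [Module.Finite R N]
    (hN : IsExtReflexiveAwayFrom x N) : ∃ k : ℕ, ∀ (a : Ideal R) (j : ℕ), ExtVanishesThrough a j →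
      ∀ (L : Type u) [AddCommGroup L] [Module R L] [Module.Finite R L] (n : ℕ),
        a ^ n ≤ Module.annihilator R L → ExtAnnihilatedUpTo 1 (x ^ k) L N j := by
  obtain ⟨k, hk⟩ := hN.uniformlyAnnihilated ⊥
  exact ⟨k, fun a j ha L _ _ _ n hn => hk a j ha L n 1 hn (by rw [pow_one]; exact bot_le)⟩

end UniformAnnihilation

/-! ### Dimension shifting and passage to local cohomology. -/

section LocalCohomologyAnnihilation

variable {R : Type u} [CommRing R]

/-- Rees' theorem: a regular sequence in `a` of length greater than `j` forces the vanishing. -/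
lemma extVanishesThrough_of_lt_idealGrade [IsNoetherianRing R] {a : Ideal R} (ha : a ≠ ⊤) {j : ℕ}
    (hj : (j : ℕ∞) < idealGrade a) : ExtVanishesThrough a j := by
  intro L _ _ _ n hn i hi
  obtain ⟨rs, hrs⟩ := lt_iSup_iff.mp hj
  obtain ⟨⟨hmem, hreg⟩, hlen⟩ := lt_iSup_iff.mp hrs
  have hlen : j < rs.length := by exact_mod_cast hlen
  refine ModuleCat.subsingleton_ext_of_exists_isRegular a (ModuleCat.of R L) ?_
    (ModuleCat.of R R) ?_ rs hmem hreg i (lt_of_le_of_lt hi hlen)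
  · intro p hp
    have hp : Module.annihilator R L ≤ p.asIdeal := by
      rwa [Module.support_eq_zeroLocus] at hp
    exact p.isPrime.le_of_pow_le (hn.trans hp)
  · have : a • (⊤ : Submodule R R) = a := by simp
    exact lt_of_le_of_ne le_top fun h => ha (this.symm.trans h)

/-- Since `Ext^j(L, R^r) = 0`, `Ext^j(L, M)` embeds in `Ext^{j+1}` into a syzygy, and `j + (t + 1) =
(j + 1) + t` keeps the grade condition. -/
lemma exists_pow_annihilates_of_gDimLE [IsNoetherianRing R] {x : R} (t : ℕ) :
    ∀ {M : Type u} [AddCommGroup M] [Module R M] [Module.Finite R M],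
      (∀ p : PrimeSpectrum R, x ∉ p.asIdeal → GDimLE (Localization.AtPrime p.asIdeal) t
        (ModuleCat.of _ (LocalizedModule p.asIdeal.primeCompl M))) →
      ∃ k : ℕ, ∀ (a : Ideal R) (j : ℕ), ExtVanishesThrough a (j + t) →
        ∀ (L : Type u) [AddCommGroup L] [Module R L] [Module.Finite R L] (n : ℕ),
          a ^ n ≤ Module.annihilator R L → ExtAnnihilatedUpTo 1 (x ^ k) L M j := by
  induction t with
  | zero =>
    intro M _ _ _ hM
    exact IsExtReflexiveAwayFrom.exists_pow_annihilates (x := x) (N := M)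
      fun p hp => (hM p hp).toIsExtReflexive
  | succ t ih =>
    intro M _ _ _ hM
    obtain ⟨r, g, hg⟩ := Module.Finite.exists_fin' R M
    obtain ⟨k, hk⟩ := ih (M := LinearMap.ker g) fun p hp => by
      have : Module.Free (Localization.AtPrime p.asIdeal)
          (LocalizedModule p.asIdeal.primeCompl (Fin r → R)) :=
        Module.free_of_isLocalizedModule p.asIdeal.primeCompl
          (LocalizedModule.mkLinearMap p.asIdeal.primeCompl (Fin r → R))
      exact GDimLE.syzygy (n := t + 1)
        (φ := LocalizedModule.map p.asIdeal.primeCompl (LinearMap.ker g).subtype)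
        (ψ := LocalizedModule.map p.asIdeal.primeCompl g)
        (LocalizedModule.map_exact p.asIdeal.primeCompl _ _ (LinearMap.exact_subtype_ker_map g))
        (LocalizedModule.map_injective p.asIdeal.primeCompl _ (Submodule.injective_subtype _))
        (LocalizedModule.map_surjective p.asIdeal.primeCompl _ hg) (hM p hp)
    refine ⟨k, fun a j ha L _ _ _ n hn => ?_⟩
    have hR : ExtAnnihilatedUpTo 1 1 L R j :=
      ExtAnnihilatedUpTo.of_subsingleton (ha L n hn j (by omega))
    have := ExtAnnihilatedUpTo.right (LinearMap.exact_subtype_ker_map g)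
      (Submodule.injective_subtype _) hg (hR.pi_of_self r)
      (hk a (j + 1) (by rwa [add_right_comm, add_assoc]) L n hn)
    simpa using this

/-- If every `r`-multiple of a cocycle is a coboundary, then `r` annihilates the cohomology. -/
lemma smul_id_homology_eq_zero (K : CochainComplex (ModuleCat.{u} R) ℕ) (j i : ℕ) (r : R)
    (h : ∀ f : K.X i, K.d i (i + 1) f = 0 → ∃ g : K.X j, K.d j i g = r • f) :
    r • 𝟙 (K.homology i) = 0 := by
  ext z
  obtain ⟨w, rfl⟩ := (ModuleCat.epi_iff_surjective (K.homologyπ i)).mp inferInstance z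
  have hw : K.d i (i + 1) (K.iCycles i w) = 0 := by
    rw [← ConcreteCategory.comp_apply, K.iCycles_d]; rfl
  obtain ⟨g, hg⟩ := h _ hw
  have : K.toCycles j i g = r • w := by
    apply (ModuleCat.mono_iff_injective (K.iCycles i)).mp inferInstance
    rw [← ConcreteCategory.comp_apply, K.toCycles_i, hg, map_smul]
  have h2 : K.homologyπ i (K.toCycles j i g) = 0 := by
    rw [← ConcreteCategory.comp_apply, K.toCycles_comp_homologyπ]; rfl
  rw [this, map_smul] at h2
  exact h2

/-- Annihilation of `Ext` in the derived category implies that of `Ext` as a derived functor. -/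
lemma smul_id_ext_eq_zero {X Y : ModuleCat.{u} R} {i : ℕ} {r : R}
    (h : ∀ ξ : Abelian.Ext X Y i, r • ξ = 0) :
    r • 𝟙 (((Ext R (ModuleCat.{u} R) i).obj (Opposite.op X)).obj Y) = 0 := by
  let P := projectiveResolution X
  let K := P.complex.linearYonedaObj R Y
  have hK : r • 𝟙 (K.homology i) = 0 := by
    -- For `i = 0` the index `i - 1` is `0` with zero differential, so `r • f` itself must vanish.
    -- It does because `f` factors through `X`.
    refine smul_id_homology_eq_zero K (i - 1) i r fun (f : P.complex.X i ⟶ Y) hf => ?_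
    replace hf : P.complex.d (i + 1) i ≫ f = 0 := hf
    obtain _ | i := i
    · have : Epi (ShortComplex.mk _ _ P.complex_d_comp_π_f_zero).g :=
        inferInstanceAs (Epi (P.π.f 0))
      obtain ⟨e, he⟩ : ∃ e : ((ChainComplex.single₀ _).obj X).X 0 ⟶ Y, P.π.f 0 ≫ e = f :=
        ⟨P.exact₀.desc f hf, P.exact₀.g_desc f hf⟩
      have hr : r • e = 0 := by
        have hX (e : X ⟶ Y) : r • e = 0 := by
          have := h (Abelian.Ext.mk₀ e)
          rwa [← Abelian.Ext.mk₀_smul, Abelian.Ext.mk₀_eq_zero_iff] at this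
        exact hX e
      refine ⟨0, ?_⟩
      rw [map_zero]
      change 0 = r • f
      rw [← he, ← Linear.comp_smul, hr, Limits.comp_zero]
    · have hr : r • P.extMk f (i + 1 + 1) rfl hf = 0 := h _
      rw [Abelian.Ext.smul_eq_comp_mk₀, P.extMk_comp_mk₀, P.extMk_eq_zero_iff _ _ _ _ i rfl] at hr
      obtain ⟨g, hg⟩ := hr
      refine ⟨g, ?_⟩
      change P.complex.d (i + 1) i ≫ g = r • f
      rw [hg, Linear.comp_smul, Category.comp_id]
  let e := P.isoExt (R := R) i Y
  rw [← cancel_mono e.hom, Linear.smul_comp, Category.id_comp, Limits.zero_comp,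
    ← Category.comp_id e.hom, ← Linear.comp_smul, hK, Limits.comp_zero]

lemma smul_id_eq_zero_of_isColimit {J C : Type*} [Category J] [Category C] [Preadditive C]
    [Linear R C] {F : J ⥤ C} {c : Limits.Cocone F} (hc : Limits.IsColimit c) {r : R}
    (h : ∀ j, r • 𝟙 (F.obj j) = 0) : r • 𝟙 c.pt = 0 := by
  refine hc.hom_ext fun j => ?_
  rw [Linear.comp_smul, Category.comp_id, Limits.comp_zero, ← Category.id_comp (c.ι.app j)]
  exact (Linear.smul_comp _ _ _ r (𝟙 _) (c.ι.app j)).symm.trans (by rw [h, Limits.zero_comp])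

lemma smul_localCohomology_eq_zero {a : Ideal R} {i : ℕ} {M : ModuleCat.{u} R} {r : R}
    (h : ∀ (n : ℕ) (ξ : Abelian.Ext (ModuleCat.of R (R ⧸ a ^ n)) M i), r • ξ = 0)
    (z : (localCohomology a i).obj M) : r • z = 0 := by
  have hid := smul_id_eq_zero_of_isColimit (R := R) (r := r)
    (Limits.isColimitOfPreserves ((evaluation _ _).obj M) (Limits.colimit.isColimit
      (localCohomology.diagram (localCohomology.idealPowersDiagram a) i)))
    fun n => smul_id_ext_eq_zero (h n.unop.unop)
  exact congrArg (fun φ => φ.hom z) hid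

end LocalCohomologyAnnihilation

theorem lemma2p7 (R : Type u) [CommRing R] [IsNoetherianRing R]
    (M : Type u) [AddCommGroup M] [Module R M] [Module.Finite R M] (t : WithBot ℕ) :
    ∃ k : ℕ, ∀ a : Ideal R, a ≠ ⊤ → ∀ i : ℕ,
      -- `i < grade(a, R) - t`, where `grade(a, R) - (-∞) = ∞`
      ((i : ℕ∞) : WithBot ℕ∞) + toExtended t < ((idealGrade a : ℕ∞) : WithBot ℕ∞) →
        gDimIdeal R M t ^ k •
          (⊤ : Submodule R ((localCohomology a i).obj (ModuleCat.of R M))) = ⊥ := by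
  -- Collecting all the annihilators in one ideal makes the exponent for `c_t(M)` independent of
  -- `a`, `i` and `n`.
  let J : Ideal R := ⨅ (a : Ideal R) (_ : a ≠ ⊤) (i : ℕ)
    (_ : ((i : ℕ∞) : WithBot ℕ∞) + toExtended t < ((idealGrade a : ℕ∞) : WithBot ℕ∞)) (n : ℕ),
    Module.annihilator R (Abelian.Ext (ModuleCat.of R (R ⧸ a ^ n)) (ModuleCat.of R M) i)
  have hJ : gDimIdeal R M t ≤ J.radical := by
    intro x hx
    have hloc : ∀ p : PrimeSpectrum R, x ∉ p.asIdeal → ¬ toExtended t <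
        gDim (Localization.AtPrime p.asIdeal) (LocalizedModule p.asIdeal.primeCompl M) := by
      intro p hp hlt
      exact hp ((Ideal.mem_iInf.mp ((Ideal.mem_iInf.mp hx) p)) hlt)
    induction t using WithBot.recBotCoe with
    | bot =>
      obtain ⟨e, he⟩ := exists_pow_smul_eq_zero_of_forall_subsingleton (N := M) (x := x)
        fun p hp => subsingleton_of_gDim_le_bot (hloc p hp)
      refine ⟨e, ?_⟩
      simp only [J, Ideal.mem_iInf, Module.mem_annihilator]
      intro a _ i _ n ξ
      exact ExtAnnihilatedUpTo.smul_ext_eq_zero_of_smul_right_eq_zero he ξ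
    | coe t =>
      obtain ⟨k, hk⟩ := exists_pow_annihilates_of_gDimLE (x := x) t (M := M)
        fun p hp => gDimLE_of_gDim_le (hloc p hp)
      refine ⟨k, ?_⟩
      simp only [J, Ideal.mem_iInf, Module.mem_annihilator]
      intro a ha i hi n ξ
      refine (hk a i (extVanishesThrough_of_lt_idealGrade ha ?_) (R ⧸ a ^ n) n ?_).smul_eq_zero ξ
      · have hi : (((i + t : ℕ) : ℕ∞) : WithBot ℕ∞) < ((idealGrade a : ℕ∞) : WithBot ℕ∞) := by
          refine lt_of_eq_of_lt ?_ hi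
          push_cast
          rfl
        exact WithBot.coe_lt_coe.mp hi
      · rw [Ideal.annihilator_quotient]
  obtain ⟨k, hk⟩ := Ideal.exists_pow_le_of_le_radical_of_fg hJ
    (IsNoetherian.noetherian (gDimIdeal R M t))
  refine ⟨k, fun a ha i hi => ?_⟩
  rw [eq_bot_iff, Submodule.smul_le]
  intro r hr z _
  refine (Submodule.mem_bot R).mpr (smul_localCohomology_eq_zero (fun n ξ => ?_) z)
  have hrJ := hk hr
  simp only [J, Ideal.mem_iInf, Module.mem_annihilator] at hrJ
  exact hrJ a ha i hi n ξ
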